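/- Let $L=D-A$, $\mathcal L=D^{-1/2}LD^{-1/2}$ and $\Delta=D^{-1}L$ be the combinatorial Laplacian, the normalized Laplacian and the discrete Laplace operator of a finite graph with adjacency matrix $A$ and degree matrix $D$. Its normalized Green's function is $\mathcal G=\sum_{\lambda_j>0}\lambda_j^{-1}\phi_j\phi_j^*$, where $(\lambda_j,\phi_j)$ is an orthonormal eigensystem of $\mathcal L$; the Green's functions belonging to $L$, $\mathcal L$, $\Delta$ are $D^{-1/2}\mathcal G D^{-1/2}$, $\mathcal G$ and $D^{-1/2}\mathcal G D^{1/2}$, respectively. The machine model is a real RAM: a program has a memory of $w$-bit words and a memory of real numbers, both with indirect addressing; each of the following takes one step: an arithmetic operation or comparison on words, a memory access, an exact operation $+,-,\times,\div,\sqrt{\cdot},\cos$ on real numbers, the constant $\pi$, the conversion of a word to a real number, a comparison of two real numbers. **Corollary.** For each of the three Laplacians there are a program $P$, a natural number $c$ and a constant $C$ such that the following holds for all $t\ge 1$, all $m_1,\dots,m_t\ge 3$, $n=\prod_{s=1}^t m_s$, and every word length $w\ge c\log_2 n$. Started on the input $t,m_1,\dots,m_t$, the program $P$ halts after at most $$C\,t\,n^{2-1/t}\log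 n$$ steps with $n$ real numbers $g(z)$, $z\in\prod_{s=1}^t\{0,\dots,m_s-1\}$, in its memory (in mixed radix order), such that the matrix $$X\big((x_1,\dots,x_t),(y_1,\dots,y_t)\big)=g\big(|y_1-x_1|,\dots,|y_t-x_t|\big)$$ is the Green's function of the $t$-dimensional torus $C_{m_1}\times\cdots\times C_{m_t}$ (the Cartesian product of cycles) that belongs to the chosen Laplacian, and is the Moore–Penrose pseudo-inverse of that Laplacian. (Thus the pseudo-inverse is determined through its first row; the full $n\times n$ matrix is not written out.) -/

import Mathlib

/-! ### Laplacians, Green's functions and pseudo-inverses of finite graphs -/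

/-- The three Laplacians of a graph: `L = D - A`, `𝓛 = D^{-1/2} L D^{-1/2}`, `Δ = D^{-1} L`. -/
inductive LaplacianKind
  | combinatorial
  | normalized
  | discrete

section Laplacians

variable {V : Type*} [Fintype V] [DecidableEq V] (Γ : SimpleGraph V) [DecidableRel Γ.Adj]

/-- The normalized Laplacian `𝓛`. -/
noncomputable def normalizedLaplacian : Matrix V V ℝ :=
  Matrix.of fun x y =>
    if x = y then 1
    else if Γ.Adj x y then -1 / Real.sqrt ((Γ.degree x : ℝ) * (Γ.degree y : ℝ))
    else 0

/-- The discrete Laplace operator `Δ`. -/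
noncomputable def discreteLaplacian : Matrix V V ℝ :=
  Matrix.of fun x y =>
    if x = y then 1
    else if Γ.Adj x y then -1 / (Γ.degree x : ℝ)
    else 0

noncomputable def laplacian : LaplacianKind → Matrix V V ℝ
  | .combinatorial => Γ.lapMatrix ℝ
  | .normalized => normalizedLaplacian Γ
  | .discrete => discreteLaplacian Γ

theorem normalizedLaplacian_isHermitian : (normalizedLaplacian Γ).IsHermitian := by
  ext x y
  simp only [normalizedLaplacian, Matrix.conjTranspose_apply, Matrix.of_apply, star_trivial,
    eq_comm (a := y) (b := x), Γ.adj_comm y x, mul_comm (Γ.degree y : ℝ)]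

/-- The normalized Green's function `𝓖 = ∑_{λ_j > 0} λ_j⁻¹ φ_j φ_j^*`, where `(λ_j, φ_j)` is an
orthonormal eigensystem of the normalized Laplacian. -/
noncomputable def normalizedGreen : Matrix V V ℝ :=
  Matrix.of fun x y =>
    ∑ j : V,
      if 0 < (normalizedLaplacian_isHermitian Γ).eigenvalues j then
        1 / (normalizedLaplacian_isHermitian Γ).eigenvalues j
          * ((normalizedLaplacian_isHermitian Γ).eigenvectorBasis j x
            * (normalizedLaplacian_isHermitian Γ).eigenvectorBasis j y)
      else 0

/-- The Green's functions that belong to `L`, `𝓛` and `Δ`: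
`D^{-1/2} 𝓖 D^{-1/2}`, `𝓖` and `D^{-1/2} 𝓖 D^{1/2}`. -/
noncomputable def greenFunction : LaplacianKind → Matrix V V ℝ
  | .combinatorial => Matrix.of fun x y =>
      normalizedGreen Γ x y / (Real.sqrt (Γ.degree x) * Real.sqrt (Γ.degree y))
  | .normalized => normalizedGreen Γ
  | .discrete => Matrix.of fun x y =>
      normalizedGreen Γ x y * Real.sqrt (Γ.degree y) / Real.sqrt (Γ.degree x)

end Laplacians

/-- `X` is the (Moore–Penrose) pseudo-inverse of the real matrix `A`. -/
structure IsPseudoInverse {V : Type*} [Fintype V] (A X : Matrix V V ℝ) : Prop where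
  mul_mul_self : A * X * A = A
  self_mul_mul : X * A * X = X
  symm_left : (A * X).transpose = A * X
  symm_right : (X * A).transpose = X * A

/-! ### The torus -/

/-- The torus `C_{m 0} × ⋯ × C_{m (t-1)}`, the Cartesian product of cycles. -/
def torus {t : ℕ} (m : Fin t → ℕ) : SimpleGraph (∀ s, Fin (m s)) where
  Adj x y := ∃ s, (SimpleGraph.cycleGraph (m s)).Adj (x s) (y s) ∧ ∀ r, r ≠ s → x r = y r
  symm := ⟨fun _ _ ⟨s, h, h'⟩ => ⟨s, h.symm, fun r hr => (h' r hr).symm⟩⟩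
  loopless := ⟨fun _ ⟨_, h, _⟩ => h.ne rfl⟩

instance {t : ℕ} (m : Fin t → ℕ) : DecidableRel (torus m).Adj := fun x y =>
  inferInstanceAs (Decidable
    (∃ s, (SimpleGraph.cycleGraph (m s)).Adj (x s) (y s) ∧ ∀ r, r ≠ s → x r = y r))

/-- The vertex `(|y_1 - x_1|, …, |y_t - x_t|)`. -/
def absDiff {t : ℕ} {m : Fin t → ℕ} (x y : ∀ s, Fin (m s)) : ∀ s, Fin (m s) :=
  fun s => ⟨((y s : ℕ) - (x s : ℕ)) + ((x s : ℕ) - (y s : ℕ)), by omega⟩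

/-! ### The real RAM

A random access machine with two memories: one holds words of `w` bits, the other one holds real
numbers.  Every elementary operation on words or on real numbers takes one step.  A real number can
influence the words only through a comparison of two real numbers. -/

namespace RealRAM

/-- Word expressions; `load a` is the content of the word memory at the address `a`. -/
inductive WordExpr
  | const (k : ℕ)
  | load (a : WordExpr)
  | add (a b : WordExpr)
  | sub (a b : WordExpr)
  | mul (a b : WordExpr)
  | div (a b : WordExpr)
  | mod (a b : WordExpr)
  | lt (a b : WordExpr)

/-- Real expressions; `load a` is the content of the real memory at the address `a`. -/
inductive RealExpr
  | ofWord (a : WordExpr)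
  | load (a : WordExpr)
  | pi
  | add (a b : RealExpr)
  | sub (a b : RealExpr)
  | mul (a b : RealExpr)
  | div (a b : RealExpr)
  | sqrt (a : RealExpr)
  | cos (a : RealExpr)

/-- Programs: assignments to a memory cell, sequencing, branching and loops. -/
inductive Program
  | setWord (addr val : WordExpr)
  | setReal (addr : WordExpr) (val : RealExpr)
  | seq (p q : Program)
  | ifWord (a : WordExpr) (p q : Program)
  | ifLess (a b : RealExpr) (p q : Program)
  | while (a : WordExpr) (p : Program)

/-- The contents of the two memories. -/
structure State where
  word : ℕ → ℕ
  real : ℕ → ℝ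

/-- The value of a word expression; words have `w` bits, so it is reduced modulo `2 ^ w`. -/
def WordExpr.eval (w : ℕ) (σ : State) : WordExpr → ℕ
  | const k => k % 2 ^ w
  | load a => σ.word (a.eval w σ) % 2 ^ w
  | add a b => (a.eval w σ + b.eval w σ) % 2 ^ w
  | sub a b => a.eval w σ - b.eval w σ
  | mul a b => (a.eval w σ * b.eval w σ) % 2 ^ w
  | div a b => a.eval w σ / b.eval w σ
  | mod a b => a.eval w σ % b.eval w σ
  | lt a b => (if a.eval w σ < b.eval w σ then 1 else 0) % 2 ^ w

noncomputable def RealExpr.eval (w : ℕ) (σ : State) : RealExpr → ℝ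
  | ofWord a => (a.eval w σ : ℝ)
  | load a => σ.real (a.eval w σ)
  | pi => Real.pi
  | add a b => a.eval w σ + b.eval w σ
  | sub a b => a.eval w σ - b.eval w σ
  | mul a b => a.eval w σ * b.eval w σ
  | div a b => a.eval w σ / b.eval w σ
  | sqrt a => Real.sqrt (a.eval w σ)
  | cos a => Real.cos (a.eval w σ)

/-- The number of elementary operations in the evaluation of a word expression. -/
def WordExpr.cost : WordExpr → ℕ
  | const _ => 1
  | load a => a.cost + 1
  | add a b | sub a b | mul a b | div a b | mod a b | lt a b => a.cost + b.cost + 1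

/-- The number of elementary operations in the evaluation of a real expression. -/
def RealExpr.cost : RealExpr → ℕ
  | ofWord a | load a => a.cost + 1
  | pi => 1
  | add a b | sub a b | mul a b | div a b => a.cost + b.cost + 1
  | sqrt a | cos a => a.cost + 1

/-- `Exec w p σ σ' k`: on words of `w` bits, the program `p`, started in the state `σ`, halts in
the state `σ'` after exactly `k` steps.  A nonzero word counts as true. -/
inductive Exec (w : ℕ) : Program → State → State → ℕ → Prop
  | setWord (a v : WordExpr) (σ : State) :
      Exec w (.setWord a v) σ
        ⟨Function.update σ.word (a.eval w σ) (v.eval w σ), σ.real⟩ (a.cost + v.cost + 1)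
  | setReal (a : WordExpr) (v : RealExpr) (σ : State) :
      Exec w (.setReal a v) σ
        ⟨σ.word, Function.update σ.real (a.eval w σ) (v.eval w σ)⟩ (a.cost + v.cost + 1)
  | seq {p q : Program} {σ σ' σ'' : State} {k l : ℕ} :
      Exec w p σ σ' k → Exec w q σ' σ'' l → Exec w (.seq p q) σ σ'' (k + l)
  | ifWord_true {a : WordExpr} {p q : Program} {σ σ' : State} {k : ℕ} :
      a.eval w σ ≠ 0 → Exec w p σ σ' k → Exec w (.ifWord a p q) σ σ' (a.cost + 1 + k)
  | ifWord_false {a : WordExpr} {p q : Program} {σ σ' : State} {k : ℕ} :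
      a.eval w σ = 0 → Exec w q σ σ' k → Exec w (.ifWord a p q) σ σ' (a.cost + 1 + k)
  | ifLess_true {a b : RealExpr} {p q : Program} {σ σ' : State} {k : ℕ} :
      a.eval w σ < b.eval w σ → Exec w p σ σ' k →
        Exec w (.ifLess a b p q) σ σ' (a.cost + b.cost + 1 + k)
  | ifLess_false {a b : RealExpr} {p q : Program} {σ σ' : State} {k : ℕ} :
      ¬ a.eval w σ < b.eval w σ → Exec w q σ σ' k →
        Exec w (.ifLess a b p q) σ σ' (a.cost + b.cost + 1 + k)
  | while_true {a : WordExpr} {p : Program} {σ σ' σ'' : State} {k l : ℕ} :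
      a.eval w σ ≠ 0 → Exec w p σ σ' k → Exec w (.while a p) σ' σ'' l →
        Exec w (.while a p) σ σ'' (a.cost + 1 + k + l)
  | while_false {a : WordExpr} {p : Program} {σ : State} :
      a.eval w σ = 0 → Exec w (.while a p) σ σ (a.cost + 1)

/-- The input: the words `t, m 0, …, m (t-1)` at the addresses `0, 1, …, t`; all other cells
contain `0`. -/
def inputState {t : ℕ} (m : Fin t → ℕ) : State where
  word a := if a = 0 then t else if h : a - 1 < t then m ⟨a - 1, h⟩ else 0
  real _ := 0

end RealRAM

/-- The matrix that is represented by its first row, with the row stored in the real memory of `σ`: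
the entry at `(x, y)` is the content of the cell whose address is the mixed radix number
`∑ s, |y s - x s| * ∏ r < s, m r`. -/
def matrixOfRow {t : ℕ} (m : Fin t → ℕ) (σ : RealRAM.State) :
    Matrix (∀ s, Fin (m s)) (∀ s, Fin (m s)) ℝ :=
  Matrix.of fun x y => σ.real (finPiFinEquiv (absDiff x y))

/-!
In every direction of the torus but a longest one, `J`, expand in the eigenfunctions of the cycle.
This leaves, for every frequency vector with eigenvalue `μ`, the operator `L + μ` on a cycle of
length `m = m J`, whose Green's function has a closed form: a quadratic polynomial for `μ = 0`, and
`(r ^ d + r ^ (m - d)) / ((1 - r ^ m) * (1 / r - r))` with `r + 1 / r = 2 + μ`, `0 < r < 1`, for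
`0 < μ`. So the first row of the Green's function of `L` is a sum over `n / m J ≤ n ^ (1 - 1 / t)`
modes, each of which contributes to each of the `n` entries a product of `t` factors. As the torus
is `2 * t`-regular, the three Green's functions differ only by a factor, and the uniqueness of the
pseudo-inverse identifies them with the spectral ones.
-/

/-! ### Pseudo-inverses -/

namespace IsPseudoInverse

variable {V : Type*} [Fintype V] {A X Y : Matrix V V ℝ}

theorem unique (hX : IsPseudoInverse A X) (hY : IsPseudoInverse A Y) : X = Y := by
  have hAX : A * X = A * Y := calc
    A * X = (A * X).transpose := hX.symm_left.symm
    _ = (A * Y * (A * X)).transpose := by rw [← Matrix.mul_assoc, hY.mul_mul_self]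
    _ = A * X * A * Y := by
      rw [Matrix.transpose_mul, hX.symm_left, hY.symm_left, ← Matrix.mul_assoc]
    _ = A * Y := by rw [hX.mul_mul_self]
  have hXA : X * A = Y * A := calc
    X * A = (X * A).transpose := hX.symm_right.symm
    _ = (X * A * (Y * A)).transpose := by
      rw [Matrix.mul_assoc, ← Matrix.mul_assoc A, hY.mul_mul_self]
    _ = Y * (A * X * A) := by
      rw [Matrix.transpose_mul, hX.symm_right, hY.symm_right]; simp only [Matrix.mul_assoc]
    _ = Y * A := by rw [hX.mul_mul_self]
  calc X = X * A * X := hX.self_mul_mul.symm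
    _ = Y * A * Y := by rw [hXA, Matrix.mul_assoc, hAX, ← Matrix.mul_assoc]
    _ = Y := hY.self_mul_mul

theorem smul (h : IsPseudoInverse A X) {a : ℝ} (ha : a ≠ 0) :
    IsPseudoInverse (a • A) (a⁻¹ • X) := by
  constructor <;> simp [smul_smul, ha, h.mul_mul_self, h.self_mul_mul, h.symm_left, h.symm_right]

theorem of_mul_eq_one_sub [DecidableEq V] {Q : Matrix V V ℝ} (hA : A.IsSymm) (hX : X.IsSymm)
    (hQ : Q.IsSymm) (hAQ : A * Q = 0) (hQX : Q * X = 0) (hAX : A * X = 1 - Q) :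
    IsPseudoInverse A X := by
  have hXA : X * A = 1 - Q := by
    rw [← hX.eq, ← hA.eq, ← Matrix.transpose_mul, hAX, Matrix.transpose_sub, hQ.eq,
      Matrix.transpose_one]
  constructor
  · rw [Matrix.mul_assoc, hXA, mul_sub, hAQ, mul_one, sub_zero]
  · rw [hXA, sub_mul, hQX, one_mul, sub_zero]
  · rw [hAX, Matrix.transpose_sub, hQ.eq, Matrix.transpose_one]
  · rw [hXA, Matrix.transpose_sub, hQ.eq, Matrix.transpose_one]

theorem diagonal [DecidableEq V] (d : V → ℝ) :
    IsPseudoInverse (Matrix.diagonal d) (Matrix.diagonal d⁻¹) := by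
  have inv_mul_mul_inv (a : ℝ) : a⁻¹ * a * a⁻¹ = a⁻¹ := by simpa using mul_inv_mul_cancel a⁻¹
  constructor <;> simp [Matrix.diagonal_mul_diagonal, mul_inv_mul_cancel, inv_mul_mul_inv]

theorem conj [DecidableEq V] (h : IsPseudoInverse A X) {U : Matrix V V ℝ}
    (hU : U.transpose * U = 1) :
    IsPseudoInverse (U * A * U.transpose) (U * X * U.transpose) := by
  have conj_mul (B C : Matrix V V ℝ) :
      U * B * U.transpose * (U * C * U.transpose) = U * (B * C) * U.transpose := by
    calc _ = U * B * (U.transpose * U) * C * U.transpose := by simp only [Matrix.mul_assoc]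
      _ = _ := by rw [hU, mul_one, Matrix.mul_assoc U]
  have transpose_conj (B : Matrix V V ℝ) :
      (U * B * U.transpose).transpose = U * B.transpose * U.transpose := by
    simp [Matrix.transpose_mul, Matrix.mul_assoc]
  constructor <;> simp only [conj_mul, transpose_conj, h.mul_mul_self, h.self_mul_mul,
    h.symm_left, h.symm_right]

end IsPseudoInverse

/-! ### Green's functions of regular graphs -/

section Regular

variable {V : Type*} [Fintype V] [DecidableEq V] (Γ : SimpleGraph V) [DecidableRel Γ.Adj]

theorem normalizedGreen_isPseudoInverse (hpos : (normalizedLaplacian Γ).PosSemidef) :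
    IsPseudoInverse (normalizedLaplacian Γ) (normalizedGreen Γ) := by
  have hH := normalizedLaplacian_isHermitian Γ
  set U : Matrix V V ℝ := (hH.eigenvectorUnitary : Matrix V V ℝ)
  have hUstar : star U = U.transpose := by
    rw [Matrix.star_eq_conjTranspose, Matrix.conjTranspose_eq_transpose_of_trivial]
  have hU : U.transpose * U = 1 := hUstar ▸ Unitary.coe_star_mul_self hH.eigenvectorUnitary
  have hL : normalizedLaplacian Γ = U * Matrix.diagonal hH.eigenvalues * U.transpose := by
    conv_lhs => rw [hH.spectral_theorem]
    rw [Unitary.conjStarAlgAut_apply, ← hUstar]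
    rfl
  have hG : normalizedGreen Γ = U * Matrix.diagonal hH.eigenvalues⁻¹ * U.transpose := by
    ext x y
    rw [Matrix.mul_apply]
    simp only [Matrix.mul_diagonal, normalizedGreen, Matrix.of_apply, Matrix.transpose_apply,
      Pi.inv_apply, U, Matrix.IsHermitian.eigenvectorUnitary_apply]
    refine Finset.sum_congr rfl fun j _ => ?_
    split_ifs with hj
    · rw [one_div]; ring
    · simp [le_antisymm (not_lt.1 hj) (hpos.eigenvalues_nonneg j)]
  exact hL ▸ hG ▸ (IsPseudoInverse.diagonal hH.eigenvalues).conj hU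

variable {d : ℕ}

theorem normalizedLaplacian_of_regular (hd : 0 < d) (hreg : Γ.IsRegularOfDegree d) :
    normalizedLaplacian Γ = (d : ℝ)⁻¹ • Γ.lapMatrix ℝ := by
  ext x y
  simp only [normalizedLaplacian, SimpleGraph.lapMatrix, SimpleGraph.degMatrix, Matrix.of_apply,
    Matrix.smul_apply, Matrix.sub_apply, Matrix.diagonal_apply, SimpleGraph.adjMatrix_apply,
    hreg.degree_eq, Real.sqrt_mul_self (Nat.cast_nonneg d), smul_eq_mul]
  by_cases hxy : x = y
  · subst hxy; simp [hd.ne']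
  · by_cases hadj : Γ.Adj x y <;> simp [hxy, hadj, div_eq_mul_inv]

theorem discreteLaplacian_of_regular (hd : 0 < d) (hreg : Γ.IsRegularOfDegree d) :
    discreteLaplacian Γ = (d : ℝ)⁻¹ • Γ.lapMatrix ℝ := by
  rw [← normalizedLaplacian_of_regular Γ hd hreg]
  ext x y
  simp only [normalizedLaplacian, discreteLaplacian, Matrix.of_apply, hreg.degree_eq,
    Real.sqrt_mul_self (Nat.cast_nonneg d)]

variable {X : Matrix V V ℝ}

theorem normalizedGreen_of_regular (hd : 0 < d) (hreg : Γ.IsRegularOfDegree d)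
    (hX : IsPseudoInverse (Γ.lapMatrix ℝ) X) : normalizedGreen Γ = (d : ℝ) • X := by
  have hL := normalizedLaplacian_of_regular Γ hd hreg
  have hpos : (normalizedLaplacian Γ).PosSemidef :=
    hL ▸ (SimpleGraph.posSemidef_lapMatrix ℝ Γ).smul (by positivity)
  have hX' := hX.smul (a := (d : ℝ)⁻¹) (by positivity)
  rw [← hL, inv_inv] at hX'
  exact (normalizedGreen_isPseudoInverse Γ hpos).unique hX'

/-- The factor by which the Green's function of a `d`-regular graph differs from the
pseudo-inverse of its combinatorial Laplacian. -/
def LaplacianKind.factor (d : ℕ) : LaplacianKind → ℕ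
  | .combinatorial => 1
  | .normalized | .discrete => d

theorem laplacian_isPseudoInverse_of_regular (κ : LaplacianKind) (hd : 0 < d)
    (hreg : Γ.IsRegularOfDegree d) (hX : IsPseudoInverse (Γ.lapMatrix ℝ) X) :
    IsPseudoInverse (laplacian Γ κ) ((κ.factor d : ℝ) • X) := by
  have hX' := hX.smul (a := (d : ℝ)⁻¹) (by positivity)
  rw [inv_inv] at hX'
  cases κ with
  | combinatorial => simpa [LaplacianKind.factor, laplacian] using hX
  | normalized => rwa [laplacian, normalizedLaplacian_of_regular Γ hd hreg]
  | discrete => rwa [laplacian, discreteLaplacian_of_regular Γ hd hreg]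

theorem greenFunction_of_regular (κ : LaplacianKind) (hd : 0 < d)
    (hreg : Γ.IsRegularOfDegree d) (hX : IsPseudoInverse (Γ.lapMatrix ℝ) X) :
    greenFunction Γ κ = (κ.factor d : ℝ) • X := by
  have hG := normalizedGreen_of_regular Γ hd hreg hX
  have hsqrt : Real.sqrt d ≠ 0 := by positivity
  ext x y
  cases κ with
  | combinatorial => simp [greenFunction, hG, hreg.degree_eq, LaplacianKind.factor, hd.ne']
  | normalized => simp [greenFunction, hG, LaplacianKind.factor]
  | discrete => simp [greenFunction, hG, hreg.degree_eq, LaplacianKind.factor, hsqrt]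

end Regular

/-! ### Functions on a cycle -/

/-- The function `φ` is symmetric about `m / 2`, so that `φ |y - x|` is a function of the residue
`y - x` modulo `m`. -/
def IsReflective (m : ℕ) (φ : ℕ → ℝ) : Prop :=
  ∀ ⦃j⦄, j ≤ m → φ (m - j) = φ j

theorem sum_sub_eq_sum_range {m : ℕ} (φ : ℕ → ℝ) (x : Fin m) :
    ∑ y : Fin m, φ (y - x : Fin m) = ∑ d ∈ Finset.range m, φ d := by
  have : NeZero m := ⟨x.pos.ne'⟩
  rw [Finset.sum_range]
  exact (Equiv.subRight x).sum_comp fun z : Fin m => φ z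

namespace IsReflective

variable {m : ℕ} {φ : ℕ → ℝ}

theorem apply_dist (hφ : IsReflective m φ) (x y : Fin m) :
    φ (Nat.dist x y) = φ (y - x : Fin m) := by
  have hx := x.isLt
  rcases le_or_gt x y with hxy | hxy
  · rw [Fin.sub_val_of_le hxy, Nat.dist_eq_sub_of_le hxy]
  · rw [Fin.coe_sub_iff_lt.2 hxy, Nat.dist_eq_sub_of_le_right hxy.le, ← hφ (by lia)]
    congr 1
    lia

theorem lapMatrix_cycleGraph_mulVec (hφ : IsReflective m φ) (hm : 3 ≤ m) (x y : Fin m) :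
    ((SimpleGraph.cycleGraph m).lapMatrix ℝ).mulVec (fun v => φ (v - x : Fin m)) y =
      if y = x then 2 * (φ 0 - φ 1)
      else 2 * φ (y - x : Fin m) - φ ((y - x : Fin m) + 1) - φ ((y - x : Fin m) - 1) := by
  obtain ⟨l, rfl⟩ : ∃ l, m = l + 3 := ⟨m - 3, by lia⟩
  have hsucc (z : Fin (l + 3)) : φ (z + 1 : Fin (l + 3)) = φ (z + 1) := by
    rw [Fin.val_add_one]
    split_ifs with hz
    · rw [hz, Fin.val_last, ← hφ (Nat.zero_le _), Nat.sub_zero]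
    · rfl
  have hpred (z : Fin (l + 3)) : φ (z - 1 : Fin (l + 3)) = if z = 0 then φ 1 else φ (z - 1) := by
    split_ifs with hz
    · rw [hz, ← hφ (by lia : 1 ≤ l + 3)]
      simp
    · rw [Fin.val_sub_one_of_ne_zero hz]
  have hne : y - 1 ≠ y + 1 := by
    simp only [ne_eq, sub_eq_iff_eq_add, add_assoc, left_eq_add]
    exact ne_of_beq_false rfl
  rw [SimpleGraph.lapMatrix_mulVec_apply, SimpleGraph.cycleGraph_degree_three_le,
    SimpleGraph.cycleGraph_neighborFinset, Finset.sum_pair hne, sub_right_comm, hpred,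
    add_sub_right_comm, hsucc]
  simp only [sub_eq_zero]
  split_ifs with hyx
  · simp [hyx]
    ring
  · push_cast
    ring

end IsReflective

theorem exists_sub_eq_add_one {m : ℕ} {x y : Fin m} (hyx : y ≠ x) :
    ∃ d, ((y - x : Fin m) : ℕ) = d + 1 := by
  have : NeZero m := ⟨x.pos.ne'⟩
  exact Nat.exists_eq_add_one_of_ne_zero (Fin.val_ne_zero_iff.2 (sub_ne_zero.2 hyx))

/-- The `k`-th cosine eigenvector of the cycle of length `l`, as a function of `|y - x|`. -/
noncomputable def cycleMode (l k d : ℕ) : ℝ :=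
  Real.cos (2 * Real.pi * ((k : ℝ) * d) / l)

/-- The eigenvalue of the Laplacian of the cycle of length `l` at `cycleMode l k`. -/
noncomputable def cycleEigenvalue (l k : ℕ) : ℝ :=
  2 - 2 * Real.cos (2 * Real.pi * k / l)

theorem cycleMode_zero_left (l d : ℕ) : cycleMode l 0 d = 1 := by
  simp [cycleMode]

theorem cycleMode_comm (l k d : ℕ) : cycleMode l k d = cycleMode l d k := by
  rw [cycleMode, cycleMode, mul_comm (k : ℝ)]

theorem cycleEigenvalue_zero (l : ℕ) : cycleEigenvalue l 0 = 0 := by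
  simp [cycleEigenvalue]

theorem cycleEigenvalue_nonneg (l k : ℕ) : 0 ≤ cycleEigenvalue l k := by
  unfold cycleEigenvalue
  linarith [Real.cos_le_one (2 * Real.pi * k / l)]

theorem cycleEigenvalue_eq_zero_iff {l k : ℕ} (hk : k < l) : cycleEigenvalue l k = 0 ↔ k = 0 := by
  have hl : (0 : ℝ) < l := by exact_mod_cast k.zero_le.trans_lt hk
  have hlt : 2 * Real.pi * k / l < 2 * Real.pi := by
    rw [div_lt_iff₀ hl]
    gcongr
  have hpos : 0 ≤ 2 * Real.pi * k / l := by positivity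
  rw [cycleEigenvalue, sub_eq_zero, eq_comm, mul_eq_left₀ two_ne_zero,
    Real.cos_eq_one_iff_of_lt_of_lt (by linarith [Real.pi_pos]) hlt]
  simp [hl.ne', Real.pi_ne_zero]

theorem isReflective_cycleMode {l : ℕ} (hl : l ≠ 0) (k : ℕ) : IsReflective l (cycleMode l k) := by
  intro j hj
  have hangle : 2 * Real.pi * (k * ((l - j : ℕ) : ℝ)) / l
      = k * (2 * Real.pi) - 2 * Real.pi * (k * j) / l := by
    rw [Nat.cast_sub hj]
    field_simp
  rw [cycleMode, cycleMode, hangle, Real.cos_nat_mul_two_pi_sub]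

theorem lapMatrix_mulVec_cycleMode {l : ℕ} (hl : 3 ≤ l) (k : ℕ) (x y : Fin l) :
    ((SimpleGraph.cycleGraph l).lapMatrix ℝ).mulVec (fun v => cycleMode l k (v - x : Fin l)) y =
      cycleEigenvalue l k * cycleMode l k (y - x : Fin l) := by
  rw [(isReflective_cycleMode (by lia) k).lapMatrix_cycleGraph_mulVec hl]
  split_ifs with hyx
  · have : NeZero l := ⟨by lia⟩
    simp [hyx, cycleMode, cycleEigenvalue]
    ring
  · obtain ⟨d, hd⟩ := exists_sub_eq_add_one hyx
    have hnext : 2 * Real.pi * (k * ((d + 1 + 1 : ℕ) : ℝ)) / l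
        = 2 * Real.pi * (k * ((d + 1 : ℕ) : ℝ)) / l + 2 * Real.pi * k / l := by
      push_cast
      ring
    have hprev : 2 * Real.pi * (k * (d : ℝ)) / l
        = 2 * Real.pi * (k * ((d + 1 : ℕ) : ℝ)) / l - 2 * Real.pi * k / l := by
      push_cast
      ring
    rw [hd, Nat.add_sub_cancel, cycleMode, cycleMode, cycleMode, hnext, hprev, Real.cos_add,
      Real.cos_sub, cycleEigenvalue]
    ring

/-- Real part of a geometric sum of powers of a root of unity. -/
theorem sum_cycleMode {l k : ℕ} (hk : k < l) :
    ∑ d ∈ Finset.range l, cycleMode l k d = if k = 0 then (l : ℝ) else 0 := by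
  split_ifs with hk0
  · simp [hk0, cycleMode_zero_left]
  have hζ := Complex.isPrimitiveRoot_exp l (by lia)
  set ζ := Complex.exp (2 * Real.pi * Complex.I / l)
  have hζk : ζ ^ k ≠ 1 := hζ.pow_ne_one_of_pos_of_lt hk0 hk
  have hgeom : ∑ d ∈ Finset.range l, (ζ ^ k) ^ d = 0 := by
    rw [geom_sum_eq hζk, ← pow_mul, mul_comm, pow_mul, hζ.pow_eq_one, one_pow, sub_self, zero_div]
  have hre (d : ℕ) : cycleMode l k d = ((ζ ^ k) ^ d).re := by
    rw [← pow_mul, ← Complex.exp_nat_mul, cycleMode, ← Complex.exp_ofReal_mul_I_re]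
    congr 2
    push_cast
    ring
  simp only [hre, ← Complex.re_sum, hgeom, Complex.zero_re]

/-- The first row of the Green's function of the cycle of length `l`. -/
noncomputable def cycleGreen (l d : ℕ) : ℝ :=
  ((l : ℝ) * l - 1) / (12 * l) - (d : ℝ) * (l - d) / (2 * l)

/-- The first row of the inverse of `L + μ` on the cycle of length `l`, where `r` is a root of
`r + 1 / r = 2 + μ`. -/
noncomputable def cycleResolvent (l : ℕ) (r : ℝ) (d : ℕ) : ℝ :=
  (r ^ d + r ^ (l - d)) / ((1 - r ^ l) * (1 / r - r))

/-- The smaller root of `r + 1 / r = 2 + μ`. -/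
noncomputable def smallRoot (μ : ℝ) : ℝ :=
  (2 + μ - Real.sqrt ((2 + μ) * (2 + μ) - 4)) / 2

/-- The first row of the pseudo-inverse of `L + μ` on the cycle of length `l`, for `0 ≤ μ`. -/
noncomputable def shiftedCycleGreen (l : ℕ) (μ : ℝ) (d : ℕ) : ℝ :=
  if μ = 0 then cycleGreen l d else cycleResolvent l (smallRoot μ) d

theorem isReflective_cycleGreen (l : ℕ) : IsReflective l (cycleGreen l) := by
  intro j hj
  rw [cycleGreen, cycleGreen, Nat.cast_sub hj]
  ring

theorem isReflective_cycleResolvent (l : ℕ) (r : ℝ) : IsReflective l (cycleResolvent l r) := by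
  intro j hj
  rw [cycleResolvent, cycleResolvent, Nat.sub_sub_self hj, add_comm]

theorem isReflective_shiftedCycleGreen (l : ℕ) (μ : ℝ) :
    IsReflective l (shiftedCycleGreen l μ) := by
  intro j hj
  simp only [shiftedCycleGreen, isReflective_cycleGreen l hj, isReflective_cycleResolvent l _ hj]

theorem smallRoot_pos {μ : ℝ} (hμ : 0 < μ) : 0 < smallRoot μ := by
  have : Real.sqrt ((2 + μ) * (2 + μ) - 4) < 2 + μ := by
    rw [Real.sqrt_lt' (by positivity)]
    nlinarith
  unfold smallRoot
  linarith

theorem smallRoot_lt_one {μ : ℝ} (hμ : 0 < μ) : smallRoot μ < 1 := by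
  have : μ < Real.sqrt ((2 + μ) * (2 + μ) - 4) := by
    rw [Real.lt_sqrt hμ.le]
    nlinarith
  unfold smallRoot
  linarith

theorem smallRoot_add_inv {μ : ℝ} (hμ : 0 < μ) : smallRoot μ + 1 / smallRoot μ = 2 + μ := by
  have hr := smallRoot_pos hμ
  have hsq := Real.mul_self_sqrt (by nlinarith : 0 ≤ (2 + μ) * (2 + μ) - 4)
  rw [← sub_eq_zero, ← mul_eq_zero_iff_right hr.ne']
  field_simp
  unfold smallRoot
  nlinarith

theorem sum_cycleGreen (l : ℕ) : ∑ d ∈ Finset.range l, cycleGreen l d = 0 := by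
  rcases Nat.eq_zero_or_pos l with rfl | hl
  · rfl
  have sum_mul_sub (a : ℝ) (n : ℕ) : ∑ d ∈ Finset.range n, ((d : ℝ) * (a - d))
      = (n - 1) * n * (3 * a - 2 * n + 1) / 6 := by
    induction n with
    | zero => simp
    | succ n ih => rw [Finset.sum_range_succ, ih]; push_cast; ring
  simp only [cycleGreen]
  rw [Finset.sum_sub_distrib, Finset.sum_const, ← Finset.sum_div, sum_mul_sub, Finset.card_range,
    nsmul_eq_mul]
  field_simp
  ring

theorem lapMatrix_mulVec_cycleGreen {l : ℕ} (hl : 3 ≤ l) (x y : Fin l) :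
    ((SimpleGraph.cycleGraph l).lapMatrix ℝ).mulVec (fun v => cycleGreen l (v - x : Fin l)) y =
      (if y = x then 1 else 0) - 1 / l := by
  rw [(isReflective_cycleGreen l).lapMatrix_cycleGraph_mulVec hl]
  split_ifs with hyx
  · simp only [cycleGreen]
    field_simp
    push_cast
    ring
  · obtain ⟨d, hd⟩ := exists_sub_eq_add_one hyx
    rw [hd, Nat.add_sub_cancel]
    simp only [cycleGreen]
    field_simp
    push_cast
    ring

theorem lapMatrix_mulVec_cycleResolvent {l : ℕ} (hl : 3 ≤ l) {r : ℝ} (hr0 : 0 < r) (hr1 : r < 1)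
    (x y : Fin l) :
    ((SimpleGraph.cycleGraph l).lapMatrix ℝ).mulVec
        (fun v => cycleResolvent l r (v - x : Fin l)) y =
      (if y = x then 1 else 0) - (r + 1 / r - 2) * cycleResolvent l r (y - x : Fin l) := by
  have hden : (1 - r ^ l) * (1 / r - r) ≠ 0 :=
    (mul_pos (sub_pos.2 (pow_lt_one₀ hr0.le hr1 (by lia)))
      (sub_pos.2 (hr1.trans (one_lt_one_div hr0 hr1)))).ne'
  rw [(isReflective_cycleResolvent l r).lapMatrix_cycleGraph_mulVec hl]
  split_ifs with hyx
  · have : NeZero l := ⟨by lia⟩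
    obtain ⟨b, rfl⟩ : ∃ b, l = b + 1 := ⟨l - 1, by lia⟩
    simp only [hyx, sub_self, Fin.val_zero, cycleResolvent, Nat.sub_zero, Nat.add_sub_cancel]
    rw [eq_sub_iff_add_eq, ← sub_div, ← mul_div_assoc, ← mul_div_assoc, ← add_div,
      div_eq_one_iff_eq hden]
    field_simp
    ring
  · obtain ⟨d, hd⟩ := exists_sub_eq_add_one hyx
    obtain ⟨b, hb⟩ : ∃ b, l = d + 1 + (b + 1) := ⟨l - (d + 2), by lia⟩
    have hnext : l - (d + 1 + 1) = b := by lia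
    have hself : l - (d + 1) = b + 1 := by lia
    have hprev : l - d = b + 2 := by lia
    simp only [hd, Nat.add_sub_cancel, cycleResolvent, hnext, hself, hprev]
    rw [zero_sub, ← mul_div_assoc, ← mul_div_assoc, ← sub_div, ← sub_div, ← neg_div]
    congr 1
    field_simp
    ring

theorem lapMatrix_mulVec_shiftedCycleGreen {l : ℕ} (hl : 3 ≤ l) {μ : ℝ} (hμ : 0 ≤ μ)
    (x y : Fin l) :
    ((SimpleGraph.cycleGraph l).lapMatrix ℝ).mulVec
        (fun v => shiftedCycleGreen l μ (v - x : Fin l)) y =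
      (if y = x then 1 else 0) - (if μ = 0 then 1 / (l : ℝ) else 0)
        - μ * shiftedCycleGreen l μ (y - x : Fin l) := by
  rcases hμ.eq_or_lt with rfl | hpos
  · simp only [shiftedCycleGreen, if_true, lapMatrix_mulVec_cycleGreen hl, zero_mul, sub_zero]
  · simp only [shiftedCycleGreen, hpos.ne', if_false, lapMatrix_mulVec_cycleResolvent hl
      (smallRoot_pos hpos) (smallRoot_lt_one hpos), smallRoot_add_inv hpos]
    ring

/-! ### The Green's function of a torus -/

section Torus

variable {t : ℕ} {m : Fin t → ℕ}

theorem sum_neighborFinset_torus_prod (f : ∀ s, Fin (m s) → ℝ) (y : ∀ s, Fin (m s)) :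
    ∑ v ∈ (torus m).neighborFinset y, ∏ s, f s (v s) =
      ∑ s, (∑ u ∈ (SimpleGraph.cycleGraph (m s)).neighborFinset (y s), f s u)
        * ∏ r ∈ Finset.univ.erase s, f r (y r) := by
  simp only [Finset.sum_mul]
  rw [Finset.sum_sigma']
  symm
  refine Finset.sum_bij (fun p _ => Function.update y p.1 p.2) ?_ ?_ ?_ ?_
  · rintro ⟨s, u⟩ hu
    simp only [Finset.mem_sigma, SimpleGraph.mem_neighborFinset] at hu ⊢
    exact ⟨s, by simpa using hu.2, fun r hr => by rw [Function.update_of_ne hr]⟩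
  · rintro ⟨s, u⟩ hu ⟨s', u'⟩ hu' heq
    simp only [Finset.mem_sigma, SimpleGraph.mem_neighborFinset] at hu hu' heq
    have hs := congrFun heq s
    rw [Function.update_self] at hs
    by_cases hss' : s = s'
    · subst hss'
      rw [hs, Function.update_self]
    · rw [Function.update_of_ne hss'] at hs
      exact absurd hs.symm hu.2.ne
  · intro v hv
    obtain ⟨s, hadj, hrest⟩ := (SimpleGraph.mem_neighborFinset _ _ _).1 hv
    refine ⟨⟨s, v s⟩, by simpa using hadj, funext fun r => ?_⟩
    by_cases hr : r = s
    · subst hr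
      simp
    · simp [Function.update_of_ne hr, hrest r hr]
  · rintro ⟨s, u⟩ _
    rw [← Finset.mul_prod_erase Finset.univ _ (Finset.mem_univ s), Function.update_self]
    congr 1
    exact Finset.prod_congr rfl fun r hr => by
      rw [Function.update_of_ne (Finset.ne_of_mem_erase hr)]

theorem degree_torus (y : ∀ s, Fin (m s)) :
    (torus m).degree y = ∑ s, (SimpleGraph.cycleGraph (m s)).degree (y s) := by
  have h := sum_neighborFinset_torus_prod (m := m) (fun _ _ => 1) y
  simp only [Finset.prod_const_one, Finset.sum_const, nsmul_eq_mul, mul_one,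
    SimpleGraph.card_neighborFinset_eq_degree] at h
  exact_mod_cast h

theorem isRegularOfDegree_torus (hm : ∀ s, 3 ≤ m s) : (torus m).IsRegularOfDegree (2 * t) := by
  intro y
  have hcycle (l : ℕ) (hl : 3 ≤ l) (v : Fin l) : (SimpleGraph.cycleGraph l).degree v = 2 := by
    obtain ⟨l, rfl⟩ : ∃ l', l = l' + 3 := ⟨l - 3, by lia⟩
    exact SimpleGraph.cycleGraph_degree_three_le
  simp [degree_torus, hcycle _ (hm _), mul_comm]

theorem lapMatrix_torus_mulVec_prod (f : ∀ s, Fin (m s) → ℝ) (y : ∀ s, Fin (m s)) :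
    ((torus m).lapMatrix ℝ).mulVec (fun v => ∏ s, f s (v s)) y =
      ∑ s, ((SimpleGraph.cycleGraph (m s)).lapMatrix ℝ).mulVec (f s) (y s)
        * ∏ r ∈ Finset.univ.erase s, f r (y r) := by
  simp only [SimpleGraph.lapMatrix_mulVec_apply, sub_mul, Finset.sum_sub_distrib, mul_assoc,
    Finset.mul_prod_erase Finset.univ (fun s => f s (y s)) (Finset.mem_univ _)]
  rw [sum_neighborFinset_torus_prod, degree_torus, Nat.cast_sum, Finset.sum_mul]

/-- The eigenvalue of the Laplacian of the torus at the product of the modes `k s`. -/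
noncomputable def modeEigenvalue (m k : Fin t → ℕ) : ℝ :=
  ∑ s, cycleEigenvalue (m s) (k s)

/-- The frequencies in the directions other than `J`, with the value `0` in the direction `J`. -/
def transverseModes (m : Fin t → ℕ) (J : Fin t) : Finset (Fin t → ℕ) :=
  Fintype.piFinset fun s => Finset.range (Function.update m J 1 s)

/-- The contribution of the mode `k` to the Green's function of the torus as a product of functions
of one coordinate: the Green's function of the shifted Laplacian in the direction `J`, and
eigenvectors in the other directions. -/
noncomputable def modeFactor (m : Fin t → ℕ) (J : Fin t) (k : Fin t → ℕ) : Fin t → ℕ → ℝ :=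
  Function.update (fun s => cycleMode (m s) (k s)) J
    (shiftedCycleGreen (m J) (modeEigenvalue m k))

/-- The first row of the Green's function of the combinatorial Laplacian of the torus. -/
noncomputable def torusRow (m : Fin t → ℕ) (J : Fin t) (d : Fin t → ℕ) : ℝ :=
  (∑ k ∈ transverseModes m J, ∏ s, modeFactor m J k s (d s))
    / ∏ s, (Function.update m J 1 s : ℝ)

/-- The matrix with the first row `torusRow`. -/
noncomputable def torusGreen (m : Fin t → ℕ) (J : Fin t) :
    Matrix (∀ s, Fin (m s)) (∀ s, Fin (m s)) ℝ :=
  Matrix.of fun x y => torusRow m J fun s => absDiff x y s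

theorem modeEigenvalue_nonneg (m k : Fin t → ℕ) : 0 ≤ modeEigenvalue m k :=
  Finset.sum_nonneg fun _ _ => cycleEigenvalue_nonneg _ _

theorem modeEigenvalue_eq_zero_iff {k : Fin t → ℕ} (hk : ∀ s, k s < m s) :
    modeEigenvalue m k = 0 ↔ k = 0 := by
  rw [modeEigenvalue, Finset.sum_eq_zero_iff_of_nonneg fun _ _ => cycleEigenvalue_nonneg _ _,
    funext_iff]
  simp [cycleEigenvalue_eq_zero_iff (hk _)]

theorem mul_prod_update_one (m : Fin t → ℕ) (J : Fin t) :
    m J * ∏ s, Function.update m J 1 s = ∏ s, m s := by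
  rw [Finset.prod_update_of_mem (Finset.mem_univ J), one_mul, Finset.sdiff_singleton_eq_erase,
    Finset.mul_prod_erase _ _ (Finset.mem_univ J)]

section

variable {J : Fin t} {k : Fin t → ℕ}

theorem apply_axis_of_mem_transverseModes (hk : k ∈ transverseModes m J) : k J = 0 := by
  simpa using Fintype.mem_piFinset.1 hk J

theorem lt_of_mem_transverseModes (hm : ∀ s, 0 < m s) (hk : k ∈ transverseModes m J)
    (s : Fin t) : k s < m s := by
  have hs := Finset.mem_range.1 (Fintype.mem_piFinset.1 hk s)
  rcases eq_or_ne s J with rfl | hsJ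
  · exact (apply_axis_of_mem_transverseModes hk).trans_lt (hm s)
  · rwa [Function.update_of_ne hsJ] at hs

theorem zero_mem_transverseModes (hm : ∀ s, 0 < m s) (J : Fin t) : 0 ∈ transverseModes m J := by
  refine Fintype.mem_piFinset.2 fun s => Finset.mem_range.2 ?_
  rcases eq_or_ne s J with rfl | hsJ
  · simp
  · simpa [Function.update_of_ne hsJ] using hm s

theorem modeFactor_axis : modeFactor m J k J = shiftedCycleGreen (m J) (modeEigenvalue m k) :=
  Function.update_self ..

theorem modeFactor_of_ne {s : Fin t} (hs : s ≠ J) : modeFactor m J k s = cycleMode (m s) (k s) :=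
  Function.update_of_ne hs ..

theorem prod_erase_modeFactor (hk : k ∈ transverseModes m J) (d : Fin t → ℕ) :
    ∏ s ∈ Finset.univ.erase J, modeFactor m J k s (d s) = ∏ s, cycleMode (m s) (k s) (d s) := by
  rw [← Finset.mul_prod_erase .univ (fun s => cycleMode (m s) (k s) (d s)) (Finset.mem_univ J),
    apply_axis_of_mem_transverseModes hk, cycleMode_zero_left, one_mul]
  exact Finset.prod_congr rfl fun s hs => by rw [modeFactor_of_ne (Finset.ne_of_mem_erase hs)]

theorem prod_modeFactor (hk : k ∈ transverseModes m J) (d : Fin t → ℕ) :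
    ∏ s, modeFactor m J k s (d s)
      = (∏ s, cycleMode (m s) (k s) (d s))
        * shiftedCycleGreen (m J) (modeEigenvalue m k) (d J) := by
  rw [← Finset.mul_prod_erase Finset.univ _ (Finset.mem_univ J), prod_erase_modeFactor hk,
    modeFactor_axis, mul_comm]

theorem lapMatrix_torus_mulVec_modeFactor (hm : ∀ s, 3 ≤ m s) (hk : k ∈ transverseModes m J)
    (x y : ∀ s, Fin (m s)) :
    ((torus m).lapMatrix ℝ).mulVec
        (fun v => ∏ s, modeFactor m J k s (v s - x s : Fin (m s))) y =
      ((if y J = x J then 1 else 0) - (if k = 0 then 1 / (m J : ℝ) else 0))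
        * ∏ s, cycleMode (m s) (k s) (y s - x s : Fin (m s)) := by
  have hkm := lt_of_mem_transverseModes (fun s => three_pos.trans_le (hm s)) hk
  set P := ∏ s, modeFactor m J k s (y s - x s : Fin (m s)) with hP
  have transverse : ∀ s ∈ Finset.univ.erase J,
      ((SimpleGraph.cycleGraph (m s)).lapMatrix ℝ).mulVec
          (fun v => modeFactor m J k s (v - x s : Fin (m s))) (y s)
        * ∏ r ∈ Finset.univ.erase s, modeFactor m J k r (y r - x r : Fin (m r))
      = cycleEigenvalue (m s) (k s) * P := fun s hs => by
    rw [hP, ← Finset.mul_prod_erase Finset.univ _ (Finset.mem_univ s), ← mul_assoc,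
      modeFactor_of_ne (Finset.ne_of_mem_erase hs), lapMatrix_mulVec_cycleMode (hm s)]
  have hμ : ∑ s ∈ Finset.univ.erase J, cycleEigenvalue (m s) (k s) = modeEigenvalue m k := by
    rw [modeEigenvalue, ← Finset.add_sum_erase Finset.univ _ (Finset.mem_univ J),
      apply_axis_of_mem_transverseModes hk, cycleEigenvalue_zero, zero_add]
  rw [lapMatrix_torus_mulVec_prod fun s v => modeFactor m J k s (v - x s : Fin (m s)),
    ← Finset.add_sum_erase Finset.univ _ (Finset.mem_univ J), Finset.sum_congr rfl transverse,
    ← Finset.sum_mul, hμ, hP, prod_modeFactor hk, prod_erase_modeFactor hk, modeFactor_axis,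
    lapMatrix_mulVec_shiftedCycleGreen (hm J) (modeEigenvalue_nonneg m k)]
  simp only [modeEigenvalue_eq_zero_iff hkm]
  ring

theorem isReflective_modeFactor (hm : ∀ s, 0 < m s) (s : Fin t) :
    IsReflective (m s) (modeFactor m J k s) := by
  rcases eq_or_ne s J with rfl | hsJ
  · rw [modeFactor_axis]
    exact isReflective_shiftedCycleGreen _ _
  · rw [modeFactor_of_ne hsJ]
    exact isReflective_cycleMode (hm s).ne' _

theorem sum_prod_modeFactor (hm : ∀ s, 0 < m s) (hk : k ∈ transverseModes m J)
    (x : ∀ s, Fin (m s)) :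
    ∑ v : ∀ s, Fin (m s), ∏ s, modeFactor m J k s (v s - x s : Fin (m s)) = 0 := by
  have hprod := Finset.prod_univ_sum (fun s => (Finset.univ : Finset (Fin (m s))))
    fun s v => modeFactor m J k s (v - x s : Fin (m s))
  rw [Fintype.piFinset_univ] at hprod
  simp only [← hprod, sum_sub_eq_sum_range, Finset.prod_eq_zero_iff, Finset.mem_univ, true_and]
  have hkm := lt_of_mem_transverseModes hm hk
  by_cases hk0 : k = 0
  · refine ⟨J, ?_⟩
    simp only [modeFactor_axis, shiftedCycleGreen, (modeEigenvalue_eq_zero_iff hkm).2 hk0, if_true]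
    exact sum_cycleGreen (m J)
  · obtain ⟨s, hs⟩ := Function.ne_iff.1 hk0
    have hsJ : s ≠ J := fun h => hs (h ▸ apply_axis_of_mem_transverseModes hk)
    exact ⟨s, by rw [modeFactor_of_ne hsJ, sum_cycleMode (hkm s)]; exact if_neg hs⟩

end

theorem sum_transverseModes_prod_cycleMode {J : Fin t} {d : Fin t → ℕ} (hd : ∀ s, d s < m s)
    (hdJ : d J = 0) :
    ∑ k ∈ transverseModes m J, ∏ s, cycleMode (m s) (k s) (d s)
      = if d = 0 then ∏ s, (Function.update m J 1 s : ℝ) else 0 := by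
  have sum_axis (s : Fin t) : ∑ j ∈ Finset.range (Function.update m J 1 s), cycleMode (m s) j (d s)
      = if d s = 0 then (Function.update m J 1 s : ℝ) else 0 := by
    rcases eq_or_ne s J with rfl | hsJ
    · simp [hdJ, cycleMode_zero_left]
    · rw [Function.update_of_ne hsJ, ← sum_cycleMode (hd s)]
      exact Finset.sum_congr rfl fun j _ => cycleMode_comm (m s) j (d s)
  rw [transverseModes, ← Finset.prod_univ_sum _ fun s j => cycleMode (m s) j (d s),
    Finset.prod_congr rfl fun s _ => sum_axis s, Finset.prod_ite_zero]
  simp [funext_iff]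

theorem sum_transverseModes_axis_mul (J : Fin t) (x y : ∀ s, Fin (m s)) :
    ∑ k ∈ transverseModes m J, (if y J = x J then 1 else 0)
        * ∏ s, cycleMode (m s) (k s) (y s - x s : Fin (m s))
      = if y = x then ∏ s, (Function.update m J 1 s : ℝ) else 0 := by
  have (s : Fin t) : NeZero (m s) := ⟨(x s).pos.ne'⟩
  by_cases hJ : y J = x J
  · simp only [if_pos hJ, one_mul]
    rw [sum_transverseModes_prod_cycleMode (fun s => (y s - x s).isLt) (by simp [hJ])]
    simp [funext_iff, sub_eq_zero]
  · simp [if_neg hJ, mt (congrFun · J) hJ]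

theorem torusGreen_apply (hm : ∀ s, 0 < m s) (J : Fin t) (x y : ∀ s, Fin (m s)) :
    torusGreen m J y x =
      (∑ k ∈ transverseModes m J, ∏ s, modeFactor m J k s (y s - x s : Fin (m s)))
        / ∏ s, (Function.update m J 1 s : ℝ) := by
  simp only [← (isReflective_modeFactor hm _).apply_dist]
  rfl

theorem isSymm_torusGreen (m : Fin t → ℕ) (J : Fin t) : (torusGreen m J).IsSymm := by
  ext x y
  simp only [torusGreen, Matrix.transpose_apply, Matrix.of_apply, absDiff, add_comm]

theorem lapMatrix_mul_torusGreen (hm : ∀ s, 3 ≤ m s) (J : Fin t) :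
    (torus m).lapMatrix ℝ * torusGreen m J = 1 - Matrix.of fun _ _ => 1 / ∏ s, (m s : ℝ) := by
  have hpos (s : Fin t) : 0 < m s := three_pos.trans_le (hm s)
  have hn : (m J : ℝ) * ∏ s, (Function.update m J 1 s : ℝ) = ∏ s, (m s : ℝ) := by
    exact_mod_cast mul_prod_update_one m J
  set q := ∏ s, (Function.update m J 1 s : ℝ)
  have hq : q ≠ 0 := right_ne_zero_of_mul
    (hn ▸ Finset.prod_ne_zero_iff.2 fun s _ => by exact_mod_cast (hpos s).ne')
  ext y x
  calc ((torus m).lapMatrix ℝ * torusGreen m J) y x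
      = (∑ k ∈ transverseModes m J, ((torus m).lapMatrix ℝ).mulVec
          (fun v => ∏ s, modeFactor m J k s (v s - x s : Fin (m s))) y) / q := by
        simp only [Matrix.mul_apply, torusGreen_apply hpos, Matrix.mulVec, dotProduct,
          ← mul_div_assoc, Finset.mul_sum]
        rw [← Finset.sum_div, Finset.sum_comm]
    _ = (∑ k ∈ transverseModes m J, ((if y J = x J then 1 else 0)
          - (if k = 0 then 1 / (m J : ℝ) else 0))
            * ∏ s, cycleMode (m s) (k s) (y s - x s : Fin (m s))) / q := by
        rw [Finset.sum_congr rfl fun k hk => lapMatrix_torus_mulVec_modeFactor hm hk x y]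
    _ = (if y = x then 1 else 0) - 1 / (m J * q) := by
        simp only [sub_mul, Finset.sum_sub_distrib]
        rw [sub_div, sum_transverseModes_axis_mul, ite_div, div_self hq, zero_div]
        simp only [ite_mul, zero_mul]
        rw [Finset.sum_ite_eq', if_pos (zero_mem_transverseModes hpos J)]
        simp only [Pi.zero_apply, cycleMode_zero_left, Finset.prod_const_one, mul_one, div_div]
    _ = _ := by rw [hn, Matrix.sub_apply, Matrix.one_apply, Matrix.of_apply]

theorem torusGreen_isPseudoInverse (hm : ∀ s, 3 ≤ m s) (J : Fin t) :
    IsPseudoInverse ((torus m).lapMatrix ℝ) (torusGreen m J) := by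
  refine .of_mul_eq_one_sub ((torus m).isSymm_lapMatrix (R := ℝ)) (isSymm_torusGreen m J)
    (Matrix.IsSymm.ext fun _ _ => rfl) ?_ ?_
    (lapMatrix_mul_torusGreen hm J)
  · ext y x
    have hrow := congrFun ((torus m).lapMatrix_mulVec_const_eq_zero (R := ℝ)) y
    simp only [Matrix.mulVec, dotProduct, mul_one, Pi.zero_apply] at hrow
    simp only [Matrix.mul_apply, Matrix.of_apply, ← Finset.sum_mul, hrow, zero_mul,
      Matrix.zero_apply]
  · have hpos (s : Fin t) : 0 < m s := three_pos.trans_le (hm s)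
    ext y x
    simp only [Matrix.mul_apply, Matrix.of_apply, ← Finset.mul_sum, torusGreen_apply hpos,
      ← Finset.sum_div, Matrix.zero_apply]
    rw [Finset.sum_comm, Finset.sum_congr rfl fun k hk => sum_prod_modeFactor hpos hk x]
    simp

end Torus

/-! ### Running times on the real RAM -/

namespace RealRAM

/-- The number of elementary operations in the text of a program, with every instruction counted
once. -/
def Program.size : Program → ℕ
  | .setWord a v => a.cost + v.cost + 1
  | .setReal a v => a.cost + v.cost + 1
  | .seq p q => p.size + q.size
  | .ifWord a p q => a.cost + 1 + p.size + q.size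
  | .ifLess a b p q => a.cost + b.cost + 1 + p.size + q.size
  | .while a p => a.cost + 1 + p.size

/-- `RunsIn w T p σ σ'`: the program `p` leads from the state `σ` to the state `σ'` in the time in
which each of its instructions can be executed `T` times. In this unit the running time of a program
is determined by its loops alone. -/
def RunsIn (w T : ℕ) (p : Program) (σ σ' : State) : Prop :=
  ∃ k ≤ T * p.size, Exec w p σ σ' k

namespace RunsIn

variable {w T T' : ℕ} {p q : Program} {σ σ' σ'' : State}

theorem mono (h : RunsIn w T p σ σ') (hT : T ≤ T') : RunsIn w T' p σ σ' :=
  let ⟨k, hk, h⟩ := h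
  ⟨k, hk.trans (Nat.mul_le_mul_right _ hT), h⟩

theorem setWord (a v : WordExpr) (σ : State) :
    RunsIn w 1 (.setWord a v) σ ⟨Function.update σ.word (a.eval w σ) (v.eval w σ), σ.real⟩ :=
  ⟨_, (one_mul _).ge, .setWord a v σ⟩

theorem setReal (a : WordExpr) (v : RealExpr) (σ : State) :
    RunsIn w 1 (.setReal a v) σ ⟨σ.word, Function.update σ.real (a.eval w σ) (v.eval w σ)⟩ :=
  ⟨_, (one_mul _).ge, .setReal a v σ⟩

theorem seq (h : RunsIn w T p σ σ') (h' : RunsIn w T q σ' σ'') : RunsIn w T (.seq p q) σ σ'' :=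
  let ⟨_, hk, h⟩ := h
  let ⟨_, hk', h'⟩ := h'
  ⟨_, (add_le_add hk hk').trans_eq (mul_add _ _ _).symm, .seq h h'⟩

theorem ifWord {a : WordExpr} (hT : 1 ≤ T) (hp : a.eval w σ ≠ 0 → RunsIn w T p σ σ')
    (hq : a.eval w σ = 0 → RunsIn w T q σ σ') : RunsIn w T (.ifWord a p q) σ σ' := by
  by_cases ha : a.eval w σ = 0
  · obtain ⟨k, hk, h⟩ := hq ha
    exact ⟨_, by rw [Program.size]; nlinarith, .ifWord_false ha h⟩
  · obtain ⟨k, hk, h⟩ := hp ha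
    exact ⟨_, by rw [Program.size]; nlinarith, .ifWord_true ha h⟩

theorem ifLess {a b : RealExpr} (hT : 1 ≤ T) (hp : a.eval w σ < b.eval w σ → RunsIn w T p σ σ')
    (hq : ¬ a.eval w σ < b.eval w σ → RunsIn w T q σ σ') :
    RunsIn w T (.ifLess a b p q) σ σ' := by
  by_cases hab : a.eval w σ < b.eval w σ
  · obtain ⟨k, hk, h⟩ := hp hab
    exact ⟨_, by rw [Program.size]; nlinarith, .ifLess_true hab h⟩
  · obtain ⟨k, hk, h⟩ := hq hab
    exact ⟨_, by rw [Program.size]; nlinarith, .ifLess_false hab h⟩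

theorem while_of_invariant {a : WordExpr} (Inv : ℕ → State → Prop) {N : ℕ} (hT : 1 ≤ T)
    (hcond : ∀ j ≤ N, ∀ σ, Inv j σ → (a.eval w σ ≠ 0 ↔ j < N))
    (hbody : ∀ j < N, ∀ σ, Inv j σ → ∃ σ', RunsIn w T p σ σ' ∧ Inv (j + 1) σ') (h0 : Inv 0 σ) :
    ∃ σ', RunsIn w (N * T + 1) (.while a p) σ σ' ∧ Inv N σ' := by
  suffices H : ∀ i j σ, j + i = N → Inv j σ →
      ∃ σ', RunsIn w (i * T + 1) (.while a p) σ σ' ∧ Inv N σ' from H N 0 σ (Nat.zero_add N) h0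
  intro i
  induction i with
  | zero =>
    rintro j σ rfl hI
    have hfalse : a.eval w σ = 0 := not_not.1 fun h => lt_irrefl _ ((hcond j le_rfl σ hI).1 h)
    exact ⟨σ, ⟨_, by rw [Program.size]; omega, .while_false hfalse⟩, hI⟩
  | succ i ih =>
    intro j σ hj hI
    have hjN : j < N := by omega
    obtain ⟨σ₁, ⟨k, hk, hrun⟩, hI₁⟩ := hbody j hjN σ hI
    obtain ⟨σ₂, ⟨l, hl, hrest⟩, hI₂⟩ := ih (j + 1) σ₁ (by omega) hI₁
    refine ⟨σ₂, ⟨_, ?_, .while_true ((hcond j hjN.le σ hI).2 hjN) hrun hrest⟩, hI₂⟩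
    rw [Program.size] at hl ⊢
    nlinarith

end RunsIn

/-- The expression `e` has the value `x` in the state `σ`, and `x` fits into a word. -/
def EvalsTo (w : ℕ) (σ : State) (e : WordExpr) (x : ℕ) : Prop := e.eval w σ = x ∧ x < 2 ^ w

namespace EvalsTo

variable {w : ℕ} {σ : State} {d e : WordExpr} {x y : ℕ}

theorem const (hx : x < 2 ^ w) : EvalsTo w σ (.const x) x :=
  ⟨Nat.mod_eq_of_lt hx, hx⟩

theorem load (he : EvalsTo w σ e x) (hx : σ.word x < 2 ^ w) :
    EvalsTo w σ (.load e) (σ.word x) :=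
  ⟨by rw [WordExpr.eval, he.1, Nat.mod_eq_of_lt hx], hx⟩

theorem add (hd : EvalsTo w σ d x) (he : EvalsTo w σ e y) (h : x + y < 2 ^ w) :
    EvalsTo w σ (.add d e) (x + y) :=
  ⟨by rw [WordExpr.eval, hd.1, he.1, Nat.mod_eq_of_lt h], h⟩

theorem sub (hd : EvalsTo w σ d x) (he : EvalsTo w σ e y) : EvalsTo w σ (.sub d e) (x - y) :=
  ⟨by rw [WordExpr.eval, hd.1, he.1], (Nat.sub_le _ _).trans_lt hd.2⟩

theorem mul (hd : EvalsTo w σ d x) (he : EvalsTo w σ e y) (h : x * y < 2 ^ w) :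
    EvalsTo w σ (.mul d e) (x * y) :=
  ⟨by rw [WordExpr.eval, hd.1, he.1, Nat.mod_eq_of_lt h], h⟩

theorem div (hd : EvalsTo w σ d x) (he : EvalsTo w σ e y) : EvalsTo w σ (.div d e) (x / y) :=
  ⟨by rw [WordExpr.eval, hd.1, he.1], (Nat.div_le_self _ _).trans_lt hd.2⟩

theorem mod (hd : EvalsTo w σ d x) (he : EvalsTo w σ e y) : EvalsTo w σ (.mod d e) (x % y) :=
  ⟨by rw [WordExpr.eval, hd.1, he.1], (Nat.mod_le _ _).trans_lt hd.2⟩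

theorem lt (hd : EvalsTo w σ d x) (he : EvalsTo w σ e y) :
    EvalsTo w σ (.lt d e) (if x < y then 1 else 0) := by
  have h : (if x < y then 1 else 0) < 2 ^ w := by
    have := he.2
    split_ifs <;> omega
  exact ⟨by rw [WordExpr.eval, hd.1, he.1, Nat.mod_eq_of_lt h], h⟩

theorem eval_lt_ne_zero_iff (hd : EvalsTo w σ d x) (he : EvalsTo w σ e y) :
    (WordExpr.lt d e).eval w σ ≠ 0 ↔ x < y := by
  rw [(hd.lt he).1]
  split_ifs with h <;> simp [h]

theorem congr (he : EvalsTo w σ e x) (h : x = y) : EvalsTo w σ e y := h ▸ he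

end EvalsTo

end RealRAM

/-! ### The memory of the program -/

theorem update_extend_apply {α β γ : Type*} [DecidableEq α] [DecidableEq β] {f : α → β}
    (hf : Function.Injective f) (g : α → γ) (e : β → γ) (i : α) (x : γ) :
    Function.update (Function.extend f g e) (f i) x
      = Function.extend f (Function.update g i x) e := by
  ext b
  by_cases hb : ∃ i', f i' = b
  · obtain ⟨i', rfl⟩ := hb
    simp only [hf.extend_apply, Function.update_apply, hf.eq_iff]
  · rw [Function.extend_apply' _ _ _ hb, Function.update_of_ne (fun h => hb ⟨i, h.symm⟩),
      Function.extend_apply' _ _ _ hb]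

theorem update_extend_of_forall_ne {α β γ : Type*} [DecidableEq β] {f : α → β}
    (hf : Function.Injective f) (g : α → γ) (e : β → γ) {b : β} (hb : ∀ i, f i ≠ b) (x : γ) :
    Function.update (Function.extend f g e) b x
      = Function.extend f g (Function.update e b x) := by
  ext b'
  by_cases hb' : ∃ i, f i = b'
  · obtain ⟨i, rfl⟩ := hb'
    rw [Function.update_of_ne (hb i), hf.extend_apply, hf.extend_apply]
  · simp only [Function.extend_apply' _ _ _ hb', Function.update_apply]

namespace RealRAM

/-- The word variables of the program. -/
inductive WordVar
  | vertexCount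
  | longest
  | mode
  | vertex
  | axis
  | modeRest
  | vertexRest
  | exponent

/-- The position of a word variable among the cells behind the input. -/
def WordVar.index : WordVar → ℕ
  | vertexCount => 0
  | longest => 1
  | mode => 2
  | vertex => 3
  | axis => 4
  | modeRest => 5
  | vertexRest => 6
  | exponent => 7

theorem WordVar.index_le (v : WordVar) : v.index ≤ 7 := by
  cases v <;> decide

theorem WordVar.index_injective : Function.Injective WordVar.index := by
  intro v v' h
  cases v <;> cases v' <;> first | rfl | exact absurd h (by decide)

theorem WordVar.address_injective (t : ℕ) :
    Function.Injective fun v : WordVar => t + (1 + v.index) :=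
  fun _ _ h => WordVar.index_injective (Nat.add_left_cancel (Nat.add_left_cancel h))

instance : DecidableEq WordVar := fun _ _ => decidable_of_iff _ WordVar.index_injective.eq_iff

/-- The real variables of the program, among them the array `power`. -/
inductive RealVar
  | eigenvalue
  | root
  | modeValue
  | power (i : ℕ)

/-- The position of a real variable among the cells behind the output. -/
def RealVar.index : RealVar → ℕ
  | eigenvalue => 0
  | root => 1
  | modeValue => 2
  | power i => 3 + i

theorem RealVar.index_injective : Function.Injective RealVar.index := by
  intro v v' h
  cases v <;> cases v' <;> simp only [RealVar.index] at h <;> first | rfl | omega | congr 1; omega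

theorem RealVar.address_injective (n : ℕ) : Function.Injective fun u : RealVar => n + u.index :=
  fun _ _ h => RealVar.index_injective (Nat.add_left_cancel h)

instance : DecidableEq RealVar := fun _ _ => decidable_of_iff _ RealVar.index_injective.eq_iff

/-- The variables whose values are of no interest after the evaluation of a mode at a vertex. -/
structure Scratch where
  axis : ℕ
  modeRest : ℕ
  vertexRest : ℕ
  modeValue : ℝ

/-- The values of the variables and the output; `out z` is the output at the vertex with the mixed
radix number `z`. -/
structure Memory extends Scratch where
  vertexCount : ℕ
  longest : ℕ
  mode : ℕ
  vertex : ℕ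
  exponent : ℕ
  eigenvalue : ℝ
  root : ℝ
  power : ℕ → ℝ
  out : ℕ → ℝ

namespace Memory

/-- The value of a word variable. -/
def get (a : Memory) : WordVar → ℕ
  | .vertexCount => a.vertexCount
  | .longest => a.longest
  | .mode => a.mode
  | .vertex => a.vertex
  | .axis => a.axis
  | .modeRest => a.modeRest
  | .vertexRest => a.vertexRest
  | .exponent => a.exponent

/-- The memory after an assignment to a word variable. -/
def set (a : Memory) : WordVar → ℕ → Memory
  | .vertexCount, x => { a with vertexCount := x }
  | .longest, x => { a with longest := x }
  | .mode, x => { a with mode := x }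
  | .vertex, x => { a with vertex := x }
  | .axis, x => { a with axis := x }
  | .modeRest, x => { a with modeRest := x }
  | .vertexRest, x => { a with vertexRest := x }
  | .exponent, x => { a with exponent := x }

/-- The value of a real variable. -/
def getReal (a : Memory) : RealVar → ℝ
  | .eigenvalue => a.eigenvalue
  | .root => a.root
  | .modeValue => a.modeValue
  | .power i => a.power i

/-- The memory after an assignment to a real variable. -/
def setReal (a : Memory) : RealVar → ℝ → Memory
  | .eigenvalue, x => { a with eigenvalue := x }
  | .root, x => { a with root := x }
  | .modeValue, x => { a with modeValue := x }
  | .power i, x => { a with power := Function.update a.power i x }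

variable (a : Memory) (v : WordVar) (u : RealVar)

theorem get_set (x : ℕ) : (a.set v x).get = Function.update a.get v x := by
  ext v'
  cases v <;> cases v' <;> rfl

theorem getReal_set (x : ℕ) : (a.set v x).getReal = a.getReal := by
  ext u'
  cases v <;> cases u' <;> rfl

theorem out_set (x : ℕ) : (a.set v x).out = a.out := by
  cases v <;> rfl

theorem set_set (x y : ℕ) : (a.set v x).set v y = a.set v y := by
  cases v <;> rfl

theorem get_setReal (x : ℝ) : (a.setReal u x).get = a.get := by
  ext v'
  cases u <;> cases v' <;> rfl

theorem getReal_setReal (x : ℝ) : (a.setReal u x).getReal = Function.update a.getReal u x := by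
  ext u'
  cases u <;> cases u' <;> simp [setReal, getReal, Function.update_apply]

theorem out_setReal (x : ℝ) : (a.setReal u x).out = a.out := by
  cases u <;> rfl

/-- The state of the machine: the word variables are stored behind the input `m`, the real variables
behind the output. -/
noncomputable def toState {t : ℕ} (m : Fin t → ℕ) (a : Memory) : State where
  word := Function.extend (fun v => t + (1 + v.index)) a.get (inputState m).word
  real := Function.extend (fun u => ∏ s, m s + u.index) a.getReal a.out

end Memory

/-- The words are long enough for the addresses and the numbers that occur in the program. -/
structure WordsFit {t : ℕ} (w : ℕ) (m : Fin t → ℕ) : Prop where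
  pos : ∀ s, 0 < m s
  dim_le : t ≤ ∏ s, m s
  lt_two_pow : 2 * ∏ s, m s + 16 < 2 ^ w

namespace WordsFit

variable {t w : ℕ} {m : Fin t → ℕ}

theorem lt (hw : WordsFit w m) {x : ℕ} (hx : x ≤ ∏ s, m s) : x < 2 ^ w := by
  have := hw.lt_two_pow
  lia

theorem length_le (hw : WordsFit w m) (s : Fin t) : m s ≤ ∏ s, m s :=
  Finset.single_le_prod' (fun s _ => hw.pos s) (Finset.mem_univ s)

end WordsFit

/-! ### Instructions in terms of the variables -/

/-- The dimension `t`. -/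
def dimension : WordExpr := .load (.const 0)

/-- The side length of the torus in the direction `e`. -/
def lengthAt (e : WordExpr) : WordExpr := .load (.add (.const 1) e)

namespace WordVar

/-- The address of a word variable. -/
def address (v : WordVar) : WordExpr := .add dimension (.const (1 + v.index))

/-- The value of a word variable. -/
def value (v : WordVar) : WordExpr := .load v.address

/-- The assignment of `e` to the word variable `v`. -/
def assign (v : WordVar) (e : WordExpr) : Program := .setWord v.address e

end WordVar

/-- The address of the real variable with the index `e`, behind the output. -/
def realAddress (e : WordExpr) : WordExpr := .add WordVar.vertexCount.value e

namespace RealVar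

/-- The value of a real variable. -/
def value (u : RealVar) : RealExpr := .load (realAddress (.const u.index))

/-- The assignment of `d` to the real variable `u`. -/
def assign (u : RealVar) (d : RealExpr) : Program := .setReal (realAddress (.const u.index)) d

end RealVar

/-- The value of the variable `power i`, where `i` is the value of `e`. -/
def powerValue (e : WordExpr) : RealExpr := .load (realAddress (.add (.const 3) e))

/-- The assignment of `d` to the variable `power i`, where `i` is the value of `e`. -/
def assignPower (e : WordExpr) (d : RealExpr) : Program :=
  .setReal (realAddress (.add (.const 3) e)) d

section Rules

variable {w t : ℕ} {m : Fin t → ℕ} {a : Memory}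

theorem word_toState_of_le {i : ℕ} (hi : i ≤ t) :
    (a.toState m).word i = (inputState m).word i :=
  Function.extend_apply' _ _ _ fun ⟨_, hv⟩ => by lia

theorem evalsTo_dimension (hw : WordsFit w m) : EvalsTo w (a.toState m) dimension t := by
  have hpow := hw.lt_two_pow
  have h0 : (a.toState m).word 0 = t := by
    simp [word_toState_of_le, inputState]
  have ht := hw.lt hw.dim_le
  exact ((EvalsTo.const (by lia)).load (h0.symm ▸ ht)).congr h0

theorem evalsTo_lengthAt (hw : WordsFit w m) {e : WordExpr} {s : Fin t}
    (he : EvalsTo w (a.toState m) e s) : EvalsTo w (a.toState m) (lengthAt e) (m s) := by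
  have hpow := hw.lt_two_pow
  have hdim := hw.dim_le
  have hs : (a.toState m).word (1 + s) = m s := by
    simp [word_toState_of_le (show 1 + s.val ≤ t by lia), inputState]
  exact (((EvalsTo.const (by lia)).add he (by lia)).load
    (hs.symm ▸ hw.lt (hw.length_le s))).congr hs

theorem evalsTo_powerIndex (hw : WordsFit w m) {e : WordExpr} {i : ℕ}
    (he : EvalsTo w (a.toState m) e i) (hi : i ≤ ∏ s, m s) :
    EvalsTo w (a.toState m) (.add (.const 3) e) (3 + i) := by
  have hpow := hw.lt_two_pow
  exact .add (.const (by lia)) he (by lia)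

namespace WordVar

theorem evalsTo_address (hw : WordsFit w m) (v : WordVar) :
    EvalsTo w (a.toState m) v.address (t + (1 + v.index)) := by
  have hpow := hw.lt_two_pow
  have hdim := hw.dim_le
  have hv := v.index_le
  exact (evalsTo_dimension hw).add (.const (by lia)) (by lia)

theorem evalsTo_value (hw : WordsFit w m) (v : WordVar) {x : ℕ} (hx : a.get v = x)
    (hxw : x < 2 ^ w) : EvalsTo w (a.toState m) v.value x := by
  have hv : (a.toState m).word (t + (1 + v.index)) = x :=
    ((address_injective t).extend_apply _ _ v).trans hx
  exact ((evalsTo_address hw v).load (hv.symm ▸ hxw)).congr hv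

theorem runsIn_assign (hw : WordsFit w m) (v : WordVar) {e : WordExpr} {x : ℕ}
    (he : EvalsTo w (a.toState m) e x) :
    RunsIn w 1 (v.assign e) (a.toState m) ((a.set v x).toState m) := by
  rw [assign]
  convert RunsIn.setWord v.address e (a.toState m) using 1
  rw [(evalsTo_address hw v).1, he.1, Memory.toState, Memory.toState, Memory.get_set,
    Memory.getReal_set, Memory.out_set, update_extend_apply (address_injective t)]

end WordVar

section

variable (hw : WordsFit w m) (hn : a.vertexCount = ∏ s, m s)
include hw hn

theorem evalsTo_vertexCount : EvalsTo w (a.toState m) WordVar.vertexCount.value (∏ s, m s) :=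
  WordVar.evalsTo_value hw _ hn (hw.lt le_rfl)

theorem evalsTo_realAddress {e : WordExpr} {i : ℕ} (he : EvalsTo w (a.toState m) e i)
    (hi : i ≤ ∏ s, m s + 3) : EvalsTo w (a.toState m) (realAddress e) (∏ s, m s + i) :=
  (evalsTo_vertexCount hw hn).add he (by have := hw.lt_two_pow; lia)

theorem eval_load_realAddress {e : WordExpr} (u : RealVar)
    (he : EvalsTo w (a.toState m) e u.index) (hu : u.index ≤ ∏ s, m s + 3) :
    (RealExpr.load (realAddress e)).eval w (a.toState m) = a.getReal u := by
  rw [RealExpr.eval, (evalsTo_realAddress hw hn he hu).1]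
  exact (RealVar.address_injective _).extend_apply _ _ u

theorem runsIn_setReal_realAddress {e : WordExpr} (u : RealVar) {d : RealExpr} {x : ℝ}
    (he : EvalsTo w (a.toState m) e u.index) (hu : u.index ≤ ∏ s, m s + 3)
    (hd : d.eval w (a.toState m) = x) :
    RunsIn w 1 (.setReal (realAddress e) d) (a.toState m) ((a.setReal u x).toState m) := by
  convert RunsIn.setReal (realAddress e) d (a.toState m) using 1
  rw [(evalsTo_realAddress hw hn he hu).1, hd, Memory.toState, Memory.toState, Memory.get_setReal,
    Memory.getReal_setReal, Memory.out_setReal,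
    update_extend_apply (RealVar.address_injective _)]

theorem RealVar.eval_value (u : RealVar) (hu : u.index ≤ 3) :
    u.value.eval w (a.toState m) = a.getReal u :=
  eval_load_realAddress hw hn u (.const (by have := hw.lt_two_pow; lia)) (by lia)

theorem RealVar.runsIn_assign (u : RealVar) (hu : u.index ≤ 3) {d : RealExpr} {x : ℝ}
    (hd : d.eval w (a.toState m) = x) :
    RunsIn w 1 (u.assign d) (a.toState m) ((a.setReal u x).toState m) :=
  runsIn_setReal_realAddress hw hn u (.const (by have := hw.lt_two_pow; lia)) (by lia) hd

theorem eval_powerValue {e : WordExpr} {i : ℕ} (he : EvalsTo w (a.toState m) e i)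
    (hi : i ≤ ∏ s, m s) : (powerValue e).eval w (a.toState m) = a.power i :=
  eval_load_realAddress hw hn (.power i) (evalsTo_powerIndex hw he hi)
    (by rw [RealVar.index]; lia)

theorem runsIn_assignPower {e : WordExpr} {i : ℕ} {d : RealExpr} {x : ℝ}
    (he : EvalsTo w (a.toState m) e i) (hi : i ≤ ∏ s, m s) (hd : d.eval w (a.toState m) = x) :
    RunsIn w 1 (assignPower e d) (a.toState m) ((a.setReal (.power i) x).toState m) :=
  runsIn_setReal_realAddress hw hn (.power i) (evalsTo_powerIndex hw he hi)
    (by rw [RealVar.index]; lia) hd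

end

theorem eval_load_out {e : WordExpr} {z : ℕ} (he : EvalsTo w (a.toState m) e z)
    (hz : z < ∏ s, m s) : (RealExpr.load e).eval w (a.toState m) = a.out z := by
  rw [RealExpr.eval, he.1]
  exact Function.extend_apply' _ _ _ fun ⟨_, hu⟩ => by lia

theorem runsIn_setOut {e : WordExpr} {z : ℕ} {d : RealExpr} {x : ℝ}
    (he : EvalsTo w (a.toState m) e z) (hz : z < ∏ s, m s) (hd : d.eval w (a.toState m) = x) :
    RunsIn w 1 (.setReal e d) (a.toState m)
      ({ a with out := Function.update a.out z x }.toState m) := by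
  convert RunsIn.setReal e d (a.toState m) using 1
  rw [he.1, hd, Memory.toState, Memory.toState,
    update_extend_of_forall_ne (RealVar.address_injective _) _ _ fun u => by lia]
  rfl

end Rules

/-- The loop over the values `0, 1, …` of the variable `v` below the value of `e`. -/
def forLoop (v : WordVar) (e : WordExpr) (body : Program) : Program :=
  .seq (v.assign (.const 0))
    (.while (.lt v.value e) (.seq body (v.assign (.add v.value (.const 1)))))

section ForLoop

variable {w t : ℕ} {m : Fin t → ℕ} {a : Memory} {body : Program} {T : ℕ}

theorem runsIn_forLoop (hw : WordsFit w m) (Inv : ℕ → Memory → Prop) {v : WordVar} {e : WordExpr}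
    {N : ℕ} (hT : 1 ≤ T) (hN : N ≤ ∏ s, m s)
    (he : ∀ j ≤ N, ∀ b, Inv j b → EvalsTo w ((b.set v j).toState m) e N)
    (hbody : ∀ j < N, ∀ b, Inv j b → ∃ b', Inv (j + 1) b' ∧
      RunsIn w T body ((b.set v j).toState m) ((b'.set v j).toState m))
    (h0 : Inv 0 a) :
    ∃ b, Inv N b ∧
      RunsIn w (N * T + 1) (forLoop v e body) (a.toState m) ((b.set v N).toState m) := by
  have hvalue (j : ℕ) (hj : j ≤ N) (b : Memory) : EvalsTo w ((b.set v j).toState m) v.value j :=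
    WordVar.evalsTo_value hw v (by simp [Memory.get_set]) (hw.lt (hj.trans hN))
  obtain ⟨_, hloop, b, rfl, hb⟩ := RunsIn.while_of_invariant (w := w) (T := T)
    (p := .seq body (v.assign (.add v.value (.const 1)))) (a := .lt v.value e)
    (fun j σ => ∃ b : Memory, (b.set v j).toState m = σ ∧ Inv j b) (N := N) hT
    (by
      rintro j hj _ ⟨b, rfl, hb⟩
      exact (hvalue j hj b).eval_lt_ne_zero_iff (he j hj b hb))
    (by
      rintro j hj _ ⟨b, rfl, hb⟩
      obtain ⟨b', hb', hrun⟩ := hbody j hj b hb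
      have hone : 1 < 2 ^ w := by have := hw.lt_two_pow; lia
      have hincr := WordVar.runsIn_assign hw v
        ((hvalue j hj.le b').add (.const hone) (hw.lt (hN.trans' hj)))
      rw [Memory.set_set] at hincr
      exact ⟨_, hrun.seq (hincr.mono hT), b', rfl, hb'⟩)
    ⟨a, rfl, h0⟩
  have hinit := WordVar.runsIn_assign (a := a) hw v (.const (Nat.two_pow_pos w))
  exact ⟨b, hb, (hinit.mono (by lia)).seq hloop⟩

theorem runsIn_forLoop_axis (hw : WordsFit w m) (f : ℕ → Memory)
    (hbody : ∀ s : Fin t, RunsIn w 1 body ({ f s with axis := s }.toState m)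
      ({ f (s + 1) with axis := s }.toState m)) :
    RunsIn w (t + 1) (forLoop .axis dimension body) ((f 0).toState m)
      ({ f t with axis := t }.toState m) := by
  obtain ⟨_, rfl, h⟩ := runsIn_forLoop (v := .axis) (e := dimension) (a := f 0) hw
    (fun j b => b = f j) le_rfl hw.dim_le (fun _ _ _ _ => evalsTo_dimension hw)
    (by rintro j hj _ rfl; exact ⟨_, rfl, hbody ⟨j, hj⟩⟩) rfl
  exact h.mono (by lia)

end ForLoop
end RealRAM

/-! ### Mixed radix numbers -/

@[to_additive]
theorem prod_filter_val_lt_succ {M : Type*} [CommMonoid M] {t : ℕ} (F : Fin t → M) (s : Fin t) :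
    ∏ i with i.val < s.val + 1, F i = (∏ i with i.val < s.val, F i) * F s := by
  have : Finset.univ.filter (fun i : Fin t => i.val < s.val + 1)
      = insert s (Finset.univ.filter fun i => i.val < s.val) := by
    ext i
    simp only [Finset.mem_filter, Finset.mem_insert, Finset.mem_univ, true_and, Fin.ext_iff]
    lia
  rw [this, Finset.prod_insert (by simp), mul_comm]

@[to_additive]
theorem prod_filter_val_lt_card {M : Type*} [CommMonoid M] {t : ℕ} (F : Fin t → M) :
    ∏ i with i.val < t, F i = ∏ i, F i := by
  simp

/-- The number with the mixed radix digits of `z` from the position `j` on. -/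
def digitQuotient {t : ℕ} (m : Fin t → ℕ) (z j : ℕ) : ℕ := z / ∏ i with i.val < j, m i

/-- The digits of `z` in the mixed radix system `m`, the least significant one first. -/
def digits {t : ℕ} (m : Fin t → ℕ) (z : ℕ) (s : Fin t) : ℕ := digitQuotient m z s % m s

theorem digitQuotient_zero {t : ℕ} (m : Fin t → ℕ) (z : ℕ) : digitQuotient m z 0 = z := by
  simp [digitQuotient]

theorem digitQuotient_le {t : ℕ} (m : Fin t → ℕ) (z j : ℕ) : digitQuotient m z j ≤ z :=
  Nat.div_le_self _ _

theorem digitQuotient_succ {t : ℕ} (m : Fin t → ℕ) (z : ℕ) (s : Fin t) :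
    digitQuotient m z (s + 1) = digitQuotient m z s / m s := by
  rw [digitQuotient, digitQuotient, prod_filter_val_lt_succ, Nat.div_div_eq_div_mul]

theorem digits_eq_finPiFinEquiv_symm {t : ℕ} (m : Fin t → ℕ) (z : Fin (∏ s, m s)) (s : Fin t) :
    digits m z s = finPiFinEquiv.symm z s := by
  have h : ∏ j : Fin s, m (Fin.castLE s.is_lt.le j) = ∏ i with i.val < s.val, m i := by
    have hs : Finset.univ.filter (fun i : Fin t => i.val < s.val)
        = Finset.univ.map (Fin.castLEEmb s.is_lt.le) := by
      ext i
      simp only [Finset.mem_filter, Finset.mem_univ, true_and, Finset.mem_map]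
      exact ⟨fun hi => ⟨⟨i, hi⟩, rfl⟩, by rintro ⟨j, rfl⟩; exact j.is_lt⟩
    rw [hs, Finset.prod_map]
    rfl
  rw [digits, digitQuotient, ← h]
  rfl

theorem digits_finPiFinEquiv {t : ℕ} {m : Fin t → ℕ} (d : ∀ s, Fin (m s)) :
    digits m (finPiFinEquiv d) = fun s => (d s : ℕ) := by
  ext s
  rw [digits_eq_finPiFinEquiv_symm, Equiv.symm_apply_apply]

theorem sum_range_digits {M : Type*} [AddCommMonoid M] {t : ℕ} (r : Fin t → ℕ)
    (F : (Fin t → ℕ) → M) :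
    ∑ z ∈ Finset.range (∏ s, r s), F (digits r z)
      = ∑ k ∈ Fintype.piFinset fun s => Finset.range (r s), F k := by
  rw [Finset.sum_range, ← finPiFinEquiv.sum_comp]
  simp only [digits_finPiFinEquiv]
  refine Finset.sum_nbij (fun d s => (d s : ℕ)) ?_ ?_ ?_ fun _ _ => rfl
  · exact fun d _ => Fintype.mem_piFinset.2 fun s => Finset.mem_range.2 (d s).is_lt
  · exact fun d _ d' _ h => funext fun s => Fin.ext (congrFun h s)
  · exact fun k hk => ⟨fun s => ⟨k s, Finset.mem_range.1 (Fintype.mem_piFinset.1 hk s)⟩, by simp⟩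

/-! ### The program -/

namespace RealRAM

open WordVar RealVar

/-- The side length in the direction `axis`. -/
def axisLength : WordExpr := lengthAt axis.value

/-- The largest side length. -/
def maxLength : WordExpr := lengthAt longest.value

/-- Whether `axis` differs from the direction `longest`. -/
def isTransverse : WordExpr := .add (.lt axis.value longest.value) (.lt longest.value axis.value)

/-- The number of frequencies in the direction `axis`: only one in the direction `longest`. -/
def axisRadix : WordExpr := .add (.const 1) (.mul (.sub axisLength (.const 1)) isTransverse)

/-- The frequency of the current mode in the direction `axis`. -/
def modeDigit : WordExpr := .mod modeRest.value axisRadix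

/-- The coordinate of the current vertex in the direction `axis`. -/
def vertexDigit : WordExpr := .mod vertexRest.value axisLength

/-- A natural number as a real number. -/
def number (k : ℕ) : RealExpr := .ofWord (.const k)

/-- The expression `cos (2 * π * x / l)`, where `l` is the side length in the direction `axis`. -/
def cosTurn (x : RealExpr) : RealExpr :=
  .cos (.div (.mul (.mul (number 2) .pi) x) (.ofWord axisLength))

/-- Takes the direction `axis` into account in `vertexCount` and `longest`. -/
def scanAxis : Program :=
  .seq (vertexCount.assign (.mul vertexCount.value axisLength)) <|
    .ifWord (.lt maxLength axisLength) (longest.assign axis.value) (longest.assign longest.value)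

/-- Computes the number of vertices and a direction in which the torus is longest. -/
def scan : Program :=
  .seq (vertexCount.assign (.const 1)) (forLoop .axis dimension scanAxis)

/-- Removes the frequency in the direction `axis` from `modeRest`. -/
def dropModeDigit : Program := modeRest.assign (.div modeRest.value axisRadix)

/-- Removes the coordinate in the direction `axis` from `vertexRest`. -/
def dropVertexDigit : Program := vertexRest.assign (.div vertexRest.value axisLength)

/-- Adds the contribution of the direction `axis` to the eigenvalue of the current mode. -/
def addCycleEigenvalue : Program :=
  .seq
    (eigenvalue.assign
      (.add eigenvalue.value (.sub (number 2) (.mul (number 2) (cosTurn (.ofWord modeDigit))))))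
    dropModeDigit

/-- Computes the eigenvalue of the current mode. -/
def computeEigenvalue : Program :=
  .seq (modeRest.assign mode.value) <|
    .seq (eigenvalue.assign (number 0)) <|
      forLoop .axis dimension addCycleEigenvalue

/-- The expression for `smallRoot` at the eigenvalue of the current mode. -/
def smallRootExpr : RealExpr :=
  let c : RealExpr := .add (number 2) eigenvalue.value
  .div (.sub c (.sqrt (.sub (.mul c c) (number 4)))) (number 2)

/-- Computes the power of the root with the exponent `exponent + 1` from the preceding one. -/
def computeNextPower : Program :=
  assignPower (.add exponent.value (.const 1)) (.mul (powerValue exponent.value) root.value)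

/-- Computes the root that `smallRoot` assigns to the eigenvalue, and its powers. -/
def computePowers : Program :=
  .seq (root.assign smallRootExpr) <|
    .seq (assignPower (.const 0) (number 1)) <|
      forLoop .exponent maxLength computeNextPower

/-- The expression for `cycleGreen` at the current vertex. -/
def greenExpr : RealExpr :=
  let l : RealExpr := .ofWord axisLength
  let d : RealExpr := .ofWord vertexDigit
  .sub (.div (.sub (.mul l l) (number 1)) (.mul (number 12) l))
    (.div (.mul d (.sub l d)) (.mul (number 2) l))

/-- The expression for `cycleResolvent` at the current vertex. -/
def resolventExpr : RealExpr :=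
  .div (.add (powerValue vertexDigit) (powerValue (.sub axisLength vertexDigit)))
    (.mul (.sub (number 1) (powerValue axisLength))
      (.sub (.div (number 1) root.value) root.value))

/-- Multiplies `modeValue` by the value of `x`. -/
def multiplyModeValue (x : RealExpr) : Program := modeValue.assign (.mul modeValue.value x)

/-- Multiplies `modeValue` by the factor `modeFactor` that belongs to the direction `axis`. -/
def multiplyModeFactor : Program :=
  .ifWord isTransverse
    (multiplyModeValue (cosTurn (.mul (.ofWord modeDigit) (.ofWord vertexDigit))))
    (.ifLess (number 0) eigenvalue.value (multiplyModeValue resolventExpr)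
      (multiplyModeValue greenExpr))

/-- Takes the direction `axis` into account in `modeValue`. -/
def visitAxis : Program := .seq multiplyModeFactor (.seq dropModeDigit dropVertexDigit)

/-- Computes the contribution of the current mode at the current vertex. -/
def evaluateMode : Program :=
  .seq (modeRest.assign mode.value) <|
    .seq (vertexRest.assign vertex.value) <|
      .seq (modeValue.assign (number 1)) <|
        forLoop .axis dimension visitAxis

/-- The number of modes with frequency `0` in the direction `longest`. -/
def modeCount : WordExpr := .div vertexCount.value maxLength

/-- Adds the contribution of the current mode, multiplied by `scale`, to the output at the current
vertex. -/
def addToOutput (scale : RealExpr) : Program :=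
  .setReal vertex.value <|
    .add (.load vertex.value) (.mul scale (.div modeValue.value (.ofWord modeCount)))

/-- Adds the contribution of the current mode, multiplied by `scale`, to the whole output. -/
def addMode (scale : RealExpr) : Program :=
  .seq computeEigenvalue <|
    .seq computePowers <|
      forLoop .vertex vertexCount.value (.seq evaluateMode (addToOutput scale))

/-- Computes the first row of the Green's function of the combinatorial Laplacian of the torus,
multiplied by `scale`. -/
def greenProgram (scale : RealExpr) : Program :=
  .seq scan (forLoop .mode modeCount (addMode scale))

section

variable {w t : ℕ} {m : Fin t → ℕ} {a : Memory} {s J : Fin t}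

theorem evalsTo_axisLength (hw : WordsFit w m) (hs : a.axis = s) :
    EvalsTo w (a.toState m) axisLength (m s) :=
  evalsTo_lengthAt hw (evalsTo_value hw axis hs (hw.lt (s.is_lt.le.trans hw.dim_le)))

theorem evalsTo_maxLength (hw : WordsFit w m) (hJ : a.longest = J) :
    EvalsTo w (a.toState m) maxLength (m J) :=
  evalsTo_lengthAt hw (evalsTo_value hw longest hJ (hw.lt (J.is_lt.le.trans hw.dim_le)))

theorem evalsTo_isTransverse (hw : WordsFit w m) (hs : a.axis = s) (hJ : a.longest = J) :
    EvalsTo w (a.toState m) isTransverse (if s = J then 0 else 1) := by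
  have hs' := evalsTo_value hw axis hs (hw.lt (s.is_lt.le.trans hw.dim_le))
  have hJ' := evalsTo_value hw longest hJ (hw.lt (J.is_lt.le.trans hw.dim_le))
  have hpow := hw.lt_two_pow
  refine ((hs'.lt hJ').add (hJ'.lt hs') (by split_ifs <;> lia)).congr ?_
  obtain h | rfl | h := lt_trichotomy s J
  · simp [h, h.ne, h.not_gt]
  · simp
  · simp [h, h.ne', h.not_gt]

theorem evalsTo_axisRadix (hw : WordsFit w m) (hs : a.axis = s) (hJ : a.longest = J) :
    EvalsTo w (a.toState m) axisRadix (Function.update m J 1 s) := by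
  have hpow := hw.lt_two_pow
  have hone : EvalsTo w (a.toState m) (.const 1) 1 := .const (by lia)
  have hpos := hw.pos s
  have hle := hw.length_le s
  have hmul : (m s - 1) * (if s = J then 0 else 1) ≤ m s - 1 := by split_ifs <;> simp
  refine (hone.add (((evalsTo_axisLength hw hs).sub hone).mul (evalsTo_isTransverse hw hs hJ)
    (by lia)) (by lia)).congr ?_
  rw [Function.update_apply]
  split_ifs <;> lia

theorem evalsTo_modeDigit (hw : WordsFit w m) (hs : a.axis = s) (hJ : a.longest = J) {k : ℕ}
    (hk : k ≤ ∏ s, m s) (hrest : a.modeRest = digitQuotient (Function.update m J 1) k s) :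
    EvalsTo w (a.toState m) modeDigit (digits (Function.update m J 1) k s) :=
  (evalsTo_value hw modeRest hrest (hw.lt ((digitQuotient_le _ _ _).trans hk))).mod
    (evalsTo_axisRadix hw hs hJ)

theorem evalsTo_vertexDigit (hw : WordsFit w m) (hs : a.axis = s) {z : ℕ}
    (hz : z ≤ ∏ s, m s) (hrest : a.vertexRest = digitQuotient m z s) :
    EvalsTo w (a.toState m) vertexDigit (digits m z s) :=
  (evalsTo_value hw vertexRest hrest (hw.lt ((digitQuotient_le _ _ _).trans hz))).mod
    (evalsTo_axisLength hw hs)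

theorem eval_ofWord {σ : State} {e : WordExpr} {x : ℕ} (he : EvalsTo w σ e x) :
    (RealExpr.ofWord e).eval w σ = x := by
  rw [RealExpr.eval, he.1]

theorem eval_number (hw : WordsFit w m) {σ : State} {k : ℕ} (hk : k ≤ 16) :
    (number k).eval w σ = k :=
  eval_ofWord (.const (by have := hw.lt_two_pow; lia))

theorem eval_cosTurn (hw : WordsFit w m) (hs : a.axis = s) (x : RealExpr) :
    (cosTurn x).eval w (a.toState m)
      = Real.cos (2 * Real.pi * x.eval w (a.toState m) / m s) := by
  simp only [cosTurn, RealExpr.eval, eval_number hw, Nat.reduceLeDiff, (evalsTo_axisLength hw hs).1,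
    Nat.cast_ofNat]

theorem runsIn_dropModeDigit (hw : WordsFit w m) (hs : a.axis = s) (hJ : a.longest = J) {k : ℕ}
    (hk : k ≤ ∏ s, m s) (hrest : a.modeRest = digitQuotient (Function.update m J 1) k s) :
    RunsIn w 1 dropModeDigit (a.toState m)
      ({ a with modeRest := digitQuotient (Function.update m J 1) k (s + 1) }.toState m) :=
  WordVar.runsIn_assign hw modeRest
    (((evalsTo_value hw modeRest hrest (hw.lt ((digitQuotient_le _ _ _).trans hk))).div
      (evalsTo_axisRadix hw hs hJ)).congr (digitQuotient_succ _ _ _).symm)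

theorem runsIn_dropVertexDigit (hw : WordsFit w m) (hs : a.axis = s) {z : ℕ}
    (hz : z ≤ ∏ s, m s) (hrest : a.vertexRest = digitQuotient m z s) :
    RunsIn w 1 dropVertexDigit (a.toState m)
      ({ a with vertexRest := digitQuotient m z (s + 1) }.toState m) :=
  WordVar.runsIn_assign hw vertexRest
    (((evalsTo_value hw vertexRest hrest (hw.lt ((digitQuotient_le _ _ _).trans hz))).div
      (evalsTo_axisLength hw hs)).congr (digitQuotient_succ _ _ _).symm)

theorem runsIn_addCycleEigenvalue (hw : WordsFit w m) (hn : a.vertexCount = ∏ s, m s)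
    (hs : a.axis = s) (hJ : a.longest = J) {k : ℕ} (hk : k ≤ ∏ s, m s)
    (hrest : a.modeRest = digitQuotient (Function.update m J 1) k s) :
    RunsIn w 1 addCycleEigenvalue (a.toState m)
      ({ a with
          modeRest := digitQuotient (Function.update m J 1) k (s + 1)
          eigenvalue := a.eigenvalue
            + cycleEigenvalue (m s) (digits (Function.update m J 1) k s) }.toState m) := by
  refine .seq (RealVar.runsIn_assign hw hn eigenvalue (by decide) ?_)
    (runsIn_dropModeDigit (a := { a with
      eigenvalue := a.eigenvalue + cycleEigenvalue (m s) (digits (Function.update m J 1) k s) })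
      hw hs hJ hk hrest)
  simp only [RealExpr.eval, RealVar.eval_value hw hn eigenvalue (by decide), eval_number hw,
    Nat.reduceLeDiff, eval_cosTurn hw hs, (evalsTo_modeDigit hw hs hJ hk hrest).1, Nat.cast_ofNat,
    Memory.getReal, cycleEigenvalue]

theorem runsIn_computeEigenvalue (hw : WordsFit w m) (hn : a.vertexCount = ∏ s, m s)
    (hJ : a.longest = J) (hmode : a.mode ≤ ∏ s, m s) :
    ∃ scr, RunsIn w (t + 1) computeEigenvalue (a.toState m)
      ({ a with
          toScratch := scr
          eigenvalue := modeEigenvalue m (digits (Function.update m J 1) a.mode) }.toState m) := by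
  let r := Function.update m J 1
  let f (j : ℕ) : Memory := { a with
    modeRest := digitQuotient r a.mode j
    eigenvalue := ∑ i with i.val < j, cycleEigenvalue (m i) (digits r a.mode i) }
  have hmodeRest := WordVar.runsIn_assign hw modeRest (evalsTo_value hw mode rfl (hw.lt hmode))
  have heigenvalue := RealVar.runsIn_assign (a := a.set modeRest a.mode) hw hn eigenvalue
    (by decide) (eval_number hw (Nat.zero_le 16))
  have hloop := runsIn_forLoop_axis hw f (body := addCycleEigenvalue) fun s => by
    simpa only [f, sum_filter_val_lt_succ] using runsIn_addCycleEigenvalue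
      (a := { f s with axis := s }) hw hn rfl hJ hmode rfl
  have hf0 : f 0 = (a.set modeRest a.mode).setReal eigenvalue (0 : ℕ) := by
    simp only [f, digitQuotient_zero, Nat.not_lt_zero, Finset.filter_false, Finset.sum_empty,
      Nat.cast_zero]
    rfl
  rw [hf0] at hloop
  simp only [f, sum_filter_val_lt_card] at hloop
  exact ⟨_, .seq (hmodeRest.mono (by lia)) (.seq (heigenvalue.mono (by lia)) hloop)⟩

theorem eval_smallRootExpr (hw : WordsFit w m) (hn : a.vertexCount = ∏ s, m s) :
    smallRootExpr.eval w (a.toState m) = smallRoot a.eigenvalue := by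
  simp only [smallRootExpr, RealExpr.eval, RealVar.eval_value hw hn eigenvalue (by decide),
    eval_number hw, Nat.reduceLeDiff, Nat.cast_ofNat, Memory.getReal, smallRoot]

theorem runsIn_computeNextPower (hw : WordsFit w m) (hn : a.vertexCount = ∏ s, m s)
    (hexp : a.exponent < ∏ s, m s) :
    RunsIn w 1 computeNextPower (a.toState m)
      ({ a with
          power := Function.update a.power (a.exponent + 1) (a.power a.exponent * a.root)
        }.toState m) := by
  have hexp' := evalsTo_value hw exponent rfl (hw.lt hexp.le)
  have hone : 1 < 2 ^ w := by have := hw.lt_two_pow; lia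
  refine runsIn_assignPower hw hn (hexp'.add (.const hone) (hw.lt hexp)) hexp ?_
  rw [RealExpr.eval, eval_powerValue hw hn hexp' hexp.le,
    RealVar.eval_value hw hn root (by decide)]
  rfl

theorem runsIn_computePowers (hw : WordsFit w m) (hn : a.vertexCount = ∏ s, m s)
    (hJ : a.longest = J) :
    ∃ p : ℕ → ℝ, (∀ i ≤ m J, p i = smallRoot a.eigenvalue ^ i) ∧
      RunsIn w (m J + 1) computePowers (a.toState m)
        ({ a with root := smallRoot a.eigenvalue, power := p, exponent := m J }.toState m) := by
  let r := smallRoot a.eigenvalue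
  have hroot := RealVar.runsIn_assign hw hn root (by decide) (eval_smallRootExpr hw hn)
  have hinit := runsIn_assignPower (a := a.setReal root r) hw hn
    (.const (Nat.two_pow_pos w)) (Nat.zero_le _) (eval_number hw (by decide : 1 ≤ 16))
  obtain ⟨_, ⟨p, rfl, hp⟩, hloop⟩ := runsIn_forLoop (v := exponent) (e := maxLength)
    (body := computeNextPower) (a := (a.setReal root r).setReal (.power 0) (1 : ℕ)) hw
    (fun j b => ∃ p, b = { a with root := r, power := p } ∧ ∀ i ≤ j, p i = r ^ i)
    le_rfl (hw.length_le J)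
    (by
      rintro j - _ ⟨p, rfl, -⟩
      exact evalsTo_maxLength hw hJ)
    (by
      rintro j hj _ ⟨p, rfl, hp⟩
      refine ⟨_, ⟨Function.update p (j + 1) (p j * r), rfl, fun i hi => ?_⟩, runsIn_computeNextPower
        (a := { a with root := r, power := p, exponent := j }) hw hn
        (hj.trans_le (hw.length_le J))⟩
      obtain rfl | hi := hi.eq_or_lt
      · rw [Function.update_self, hp j le_rfl, pow_succ]
      · rw [Function.update_of_ne hi.ne, hp i (by lia)])
    ⟨_, rfl, fun i hi => by simp [Nat.le_zero.1 hi]⟩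
  exact ⟨p, hp, .seq (hroot.mono (by lia)) (.seq (hinit.mono (by lia)) (hloop.mono (by lia)))⟩

/-- Everything that the evaluation of the current mode, with the number `a.mode`, needs has been
computed. -/
structure IsPrepared (m : Fin t → ℕ) (J : Fin t) (a : Memory) : Prop where
  vertexCount_eq : a.vertexCount = ∏ s, m s
  longest_eq : a.longest = J
  mode_le : a.mode ≤ ∏ s, m s
  eigenvalue_eq : a.eigenvalue = modeEigenvalue m (digits (Function.update m J 1) a.mode)
  root_eq : a.root = smallRoot a.eigenvalue
  power_eq : ∀ i ≤ m J, a.power i = a.root ^ i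

theorem runsIn_multiplyModeValue (hw : WordsFit w m) (hn : a.vertexCount = ∏ s, m s)
    {e : RealExpr} {x : ℝ} (he : e.eval w (a.toState m) = x) :
    RunsIn w 1 (multiplyModeValue e) (a.toState m)
      ({ a with modeValue := a.modeValue * x }.toState m) :=
  RealVar.runsIn_assign hw hn modeValue (by decide)
    (by rw [RealExpr.eval, he, RealVar.eval_value hw hn modeValue (by decide)]; rfl)

theorem eval_greenExpr (hw : WordsFit w m) (hs : a.axis = s) {d : ℕ}
    (hd : EvalsTo w (a.toState m) vertexDigit d) :
    greenExpr.eval w (a.toState m) = cycleGreen (m s) d := by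
  simp only [greenExpr, RealExpr.eval, (evalsTo_axisLength hw hs).1, hd.1, eval_number hw,
    Nat.reduceLeDiff, Nat.cast_ofNat, Nat.cast_one, cycleGreen]

theorem eval_resolventExpr (hw : WordsFit w m) (ha : IsPrepared m J a) (hs : a.axis = J) {d : ℕ}
    (hd : EvalsTo w (a.toState m) vertexDigit d) (hdJ : d ≤ m J) :
    resolventExpr.eval w (a.toState m) = cycleResolvent (m J) a.root d := by
  have hn := ha.vertexCount_eq
  have hJ := evalsTo_axisLength hw hs
  have hle := hw.length_le J
  simp only [resolventExpr, RealExpr.eval, RealVar.eval_value hw hn root (by decide),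
    eval_powerValue hw hn hd (hdJ.trans hle), eval_powerValue hw hn (hJ.sub hd) (by lia),
    eval_powerValue hw hn hJ hle, ha.power_eq _ hdJ, ha.power_eq _ (Nat.sub_le _ _),
    ha.power_eq _ le_rfl, eval_number hw, Nat.reduceLeDiff, Nat.cast_one, Memory.getReal,
    cycleResolvent]

theorem runsIn_multiplyModeFactor (hw : WordsFit w m) (ha : IsPrepared m J a) (hs : a.axis = s)
    {z : ℕ} (hz : z ≤ ∏ s, m s)
    (hmode : a.modeRest = digitQuotient (Function.update m J 1) a.mode s)
    (hvertex : a.vertexRest = digitQuotient m z s) :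
    RunsIn w 1 multiplyModeFactor (a.toState m)
      ({ a with
          modeValue := a.modeValue
            * modeFactor m J (digits (Function.update m J 1) a.mode) s (digits m z s)
        }.toState m) := by
  have hn := ha.vertexCount_eq
  have hd := evalsTo_vertexDigit hw hs hz hvertex
  have htransverse := (evalsTo_isTransverse hw hs ha.longest_eq).1
  have hk := evalsTo_modeDigit hw hs ha.longest_eq ha.mode_le hmode
  have hnonneg := modeEigenvalue_nonneg m (digits (Function.update m J 1) a.mode)
  refine .ifWord le_rfl (fun h => runsIn_multiplyModeValue hw hn ?_) fun h => ?_
  · have hsJ : s ≠ J := fun hsJ => h (by rw [htransverse, if_pos hsJ])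
    rw [eval_cosTurn hw hs, modeFactor_of_ne hsJ, RealExpr.eval, eval_ofWord hk,
      eval_ofWord hd, cycleMode]
  · obtain rfl : s = J := by
      by_contra hsJ
      rw [htransverse, if_neg hsJ] at h
      exact one_ne_zero h
    simp only [modeFactor_axis, shiftedCycleGreen]
    refine .ifLess le_rfl (fun h => runsIn_multiplyModeValue hw hn ?_) fun h =>
      runsIn_multiplyModeValue hw hn ?_
    all_goals
      rw [eval_number hw (Nat.zero_le 16), RealVar.eval_value hw hn eigenvalue (by decide),
        Nat.cast_zero, Memory.getReal, ha.eigenvalue_eq] at h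
    · rw [if_neg h.ne', eval_resolventExpr hw ha hs hd (Nat.mod_lt _ (hw.pos s)).le, ha.root_eq,
        ha.eigenvalue_eq]
    · rw [if_pos (hnonneg.antisymm' (not_lt.1 h)), eval_greenExpr hw hs hd]

theorem runsIn_visitAxis (hw : WordsFit w m) (ha : IsPrepared m J a) (hs : a.axis = s)
    {z : ℕ} (hz : z ≤ ∏ s, m s)
    (hmode : a.modeRest = digitQuotient (Function.update m J 1) a.mode s)
    (hvertex : a.vertexRest = digitQuotient m z s) :
    RunsIn w 1 visitAxis (a.toState m)
      ({ a with
          modeRest := digitQuotient (Function.update m J 1) a.mode (s + 1)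
          vertexRest := digitQuotient m z (s + 1)
          modeValue := a.modeValue
            * modeFactor m J (digits (Function.update m J 1) a.mode) s (digits m z s)
        }.toState m) := by
  let x := a.modeValue * modeFactor m J (digits (Function.update m J 1) a.mode) s (digits m z s)
  have hfactor := runsIn_multiplyModeFactor hw ha hs hz hmode hvertex
  have hmodeRest := runsIn_dropModeDigit (a := { a with modeValue := x }) hw hs ha.longest_eq
    ha.mode_le hmode
  have hvertexRest := runsIn_dropVertexDigit (a := { a with
    modeRest := digitQuotient (Function.update m J 1) a.mode (s + 1)
    modeValue := x }) hw hs hz hvertex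
  exact hfactor.seq (hmodeRest.seq hvertexRest)

/-- The contribution of the mode with the number `k` to `S * torusRow` at the vertex with the number
`z`. -/
noncomputable def modeTerm (m : Fin t → ℕ) (J : Fin t) (S : ℝ) (k z : ℕ) : ℝ :=
  S * ((∏ s, modeFactor m J (digits (Function.update m J 1) k) s (digits m z s))
    / ((∏ s, m s) / m J : ℕ))

theorem runsIn_evaluateMode (hw : WordsFit w m) (ha : IsPrepared m J a)
    (hz : a.vertex ≤ ∏ s, m s) :
    ∃ scr : Scratch,
      scr.modeValue = ∏ s, modeFactor m J (digits (Function.update m J 1) a.mode) s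
        (digits m a.vertex s) ∧
      RunsIn w (t + 1) evaluateMode (a.toState m) ({ a with toScratch := scr }.toState m) := by
  let r := Function.update m J 1
  let f (j : ℕ) : Memory := { a with
    modeRest := digitQuotient r a.mode j
    vertexRest := digitQuotient m a.vertex j
    modeValue := ∏ i with i.val < j, modeFactor m J (digits r a.mode) i (digits m a.vertex i) }
  have hmodeRest := WordVar.runsIn_assign hw modeRest (evalsTo_value hw mode rfl (hw.lt ha.mode_le))
  have hvertexRest := WordVar.runsIn_assign (a := a.set modeRest a.mode) hw vertexRest
    (evalsTo_value hw vertex rfl (hw.lt hz))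
  have hmodeValue := RealVar.runsIn_assign
    (a := (a.set modeRest a.mode).set vertexRest a.vertex) hw ha.vertexCount_eq modeValue
    (by decide) (eval_number hw (by decide : 1 ≤ 16))
  have hloop := runsIn_forLoop_axis hw f (body := visitAxis) fun s => by
    simpa only [f, prod_filter_val_lt_succ] using runsIn_visitAxis
      (a := { f s with axis := s }) hw { ha with } rfl hz rfl rfl
  have hf0 : f 0 = ((a.set modeRest a.mode).set vertexRest a.vertex).setReal modeValue (1 : ℕ) := by
    simp only [f, digitQuotient_zero, Nat.not_lt_zero, Finset.filter_false, Finset.prod_empty,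
      Nat.cast_one]
    rfl
  rw [hf0] at hloop
  simp only [f, prod_filter_val_lt_card] at hloop
  exact ⟨_, rfl, .seq (hmodeRest.mono (by lia)) (.seq (hvertexRest.mono (by lia))
    (.seq (hmodeValue.mono (by lia)) hloop))⟩

theorem evalsTo_modeCount (hw : WordsFit w m) (hn : a.vertexCount = ∏ s, m s)
    (hJ : a.longest = J) : EvalsTo w (a.toState m) modeCount ((∏ s, m s) / m J) :=
  (evalsTo_vertexCount hw hn).div (evalsTo_maxLength hw hJ)

theorem runsIn_addToOutput (hw : WordsFit w m) (hn : a.vertexCount = ∏ s, m s)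
    (hJ : a.longest = J) (hz : a.vertex < ∏ s, m s) {scale : RealExpr} {S : ℝ}
    (hscale : scale.eval w (a.toState m) = S) :
    RunsIn w 1 (addToOutput scale) (a.toState m)
      ({ a with
          out := Function.update a.out a.vertex
            (a.out a.vertex + S * (a.modeValue / ((∏ s, m s) / m J : ℕ))) }.toState m) := by
  have hvertex := evalsTo_value (a := a) hw vertex rfl (hw.lt hz.le)
  refine runsIn_setOut hvertex hz ?_
  rw [RealExpr.eval, eval_load_out hvertex hz, RealExpr.eval, hscale, RealExpr.eval,
    RealVar.eval_value hw hn modeValue (by decide), eval_ofWord (evalsTo_modeCount hw hn hJ)]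
  rfl

variable {scale : RealExpr} {S : ℝ}

theorem runsIn_addModeAtVertex (hw : WordsFit w m) (ha : IsPrepared m J a)
    (hz : a.vertex < ∏ s, m s) (hscale : ∀ b : Memory, scale.eval w (b.toState m) = S) :
    ∃ scr, RunsIn w (t + 1) (.seq evaluateMode (addToOutput scale)) (a.toState m)
      ({ a with
          toScratch := scr
          out := Function.update a.out a.vertex
            (a.out a.vertex + modeTerm m J S a.mode a.vertex) }.toState m) := by
  obtain ⟨scr, hvalue, hmode⟩ := runsIn_evaluateMode hw ha hz.le
  have hadd := runsIn_addToOutput (a := { a with toScratch := scr }) hw ha.vertexCount_eq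
    ha.longest_eq hz (hscale _)
  rw [hvalue] at hadd
  exact ⟨scr, hmode.seq (hadd.mono (by lia))⟩

theorem runsIn_forLoop_vertex (hw : WordsFit w m) (ha : IsPrepared m J a)
    (hscale : ∀ b : Memory, scale.eval w (b.toState m) = S) :
    ∃ scr out, (∀ z < ∏ s, m s, out z = a.out z + modeTerm m J S a.mode z) ∧
      RunsIn w ((∏ s, m s) * (t + 1) + 1)
        (forLoop .vertex vertexCount.value (.seq evaluateMode (addToOutput scale))) (a.toState m)
        ({ a with toScratch := scr, vertex := ∏ s, m s, out := out }.toState m) := by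
  obtain ⟨_, ⟨scr, out, rfl, hout, -⟩, hloop⟩ := runsIn_forLoop (v := vertex)
    (e := vertexCount.value) (a := a) (body := .seq evaluateMode (addToOutput scale)) hw
    (fun j b => ∃ scr out, b = { a with toScratch := scr, out := out } ∧
      (∀ z < j, out z = a.out z + modeTerm m J S a.mode z) ∧ ∀ z ≥ j, out z = a.out z)
    (Nat.le_add_left 1 t) le_rfl
    (by
      rintro j - _ ⟨scr, out, rfl, -⟩
      exact evalsTo_vertexCount hw ha.vertexCount_eq)
    (by
      rintro j hj _ ⟨scr, out, rfl, hlt, hge⟩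
      obtain ⟨scr', hadd⟩ := runsIn_addModeAtVertex
        (a := { a with toScratch := scr, vertex := j, out := out }) hw { ha with } hj hscale
      refine ⟨_, ⟨scr', Function.update out j (out j + modeTerm m J S a.mode j), rfl,
        fun z hz => ?_, fun z hz => ?_⟩, hadd⟩
      · obtain rfl | hz := (Nat.lt_succ_iff.1 hz).eq_or_lt
        · rw [Function.update_self, hge z le_rfl]
        · rw [Function.update_of_ne hz.ne, hlt z hz]
      · rw [Function.update_of_ne (by lia), hge z (by lia)])
    ⟨a.toScratch, a.out, rfl, by simp⟩
  exact ⟨scr, out, hout, hloop⟩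

theorem runsIn_addMode (hw : WordsFit w m) (hn : a.vertexCount = ∏ s, m s) (hJ : a.longest = J)
    (hmode : a.mode ≤ ∏ s, m s) (hscale : ∀ b : Memory, scale.eval w (b.toState m) = S) :
    ∃ b : Memory, b.vertexCount = ∏ s, m s ∧ b.longest = J ∧
      (∀ z < ∏ s, m s, b.out z = a.out z + modeTerm m J S a.mode z) ∧
      RunsIn w ((∏ s, m s) * (t + 1) + 1) (addMode scale) (a.toState m)
        ({ b with mode := a.mode }.toState m) := by
  let μ := modeEigenvalue m (digits (Function.update m J 1) a.mode)
  obtain ⟨scr, heigenvalue⟩ := runsIn_computeEigenvalue hw hn hJ hmode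
  obtain ⟨p, hp, hpowers⟩ := runsIn_computePowers
    (a := { a with toScratch := scr, eigenvalue := μ }) hw hn hJ
  obtain ⟨scr', out, hout, hloop⟩ := runsIn_forLoop_vertex (J := J) (a := { a with
    toScratch := scr, eigenvalue := μ, root := smallRoot μ, power := p, exponent := m J }) hw
    ⟨hn, hJ, hmode, rfl, rfl, hp⟩ hscale
  have hone : 1 ≤ ∏ s, m s := (hw.pos J).trans_le (hw.length_le J)
  have ht : t + 1 ≤ (∏ s, m s) * (t + 1) := Nat.le_mul_of_pos_left _ hone
  have hlength : m J ≤ (∏ s, m s) * (t + 1) :=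
    (hw.length_le J).trans (Nat.le_mul_of_pos_right _ t.succ_pos)
  exact ⟨{ a with
      toScratch := scr'
      vertex := ∏ s, m s
      exponent := m J
      eigenvalue := μ
      root := smallRoot μ
      power := p
      out := out }, hn, hJ, hout,
    .seq (heigenvalue.mono (by lia)) (.seq (hpowers.mono (by lia)) hloop)⟩

theorem runsIn_forLoop_mode (hw : WordsFit w m) (hn : a.vertexCount = ∏ s, m s)
    (hJ : a.longest = J) (hout : ∀ z, a.out z = 0)
    (hscale : ∀ b : Memory, scale.eval w (b.toState m) = S) :
    ∃ b : Memory,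
      (∀ z < ∏ s, m s, b.out z = ∑ k ∈ Finset.range ((∏ s, m s) / m J), modeTerm m J S k z) ∧
      RunsIn w ((∏ s, m s) / m J * ((∏ s, m s) * (t + 1) + 1) + 1)
        (forLoop .mode modeCount (addMode scale)) (a.toState m) (b.toState m) := by
  obtain ⟨b, ⟨-, -, hb⟩, hloop⟩ := runsIn_forLoop (v := mode) (e := modeCount) (a := a)
    (body := addMode scale) hw
    (fun j b => b.vertexCount = ∏ s, m s ∧ b.longest = J ∧
      ∀ z < ∏ s, m s, b.out z = ∑ k ∈ Finset.range j, modeTerm m J S k z)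
    (Nat.le_add_left 1 _) (Nat.div_le_self _ _)
    (by
      rintro j - b ⟨hbn, hbJ, -⟩
      exact evalsTo_modeCount hw hbn hbJ)
    (by
      rintro j hj b ⟨hbn, hbJ, hb⟩
      obtain ⟨b', hn', hJ', hout', hrun⟩ := runsIn_addMode (a := { b with mode := j }) hw hbn hbJ
        (hj.le.trans (Nat.div_le_self _ _)) hscale
      exact ⟨b', ⟨hn', hJ', fun z hz => by
        rw [hout' z hz, hb z hz, Finset.sum_range_succ]⟩, hrun⟩)
    ⟨hn, hJ, by simp [hout]⟩
  exact ⟨b.set mode ((∏ s, m s) / m J), hb, hloop⟩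

theorem sum_modeTerm (hJ : 0 < m J) (S : ℝ) (z : ℕ) :
    ∑ k ∈ Finset.range ((∏ s, m s) / m J), modeTerm m J S k z
      = S * torusRow m J (digits m z) := by
  have hq : (∏ s, m s) / m J = ∏ s, Function.update m J 1 s := by
    rw [← mul_prod_update_one m J, Nat.mul_div_cancel_left _ hJ]
  simp only [modeTerm, torusRow, transverseModes, hq, Nat.cast_prod]
  rw [← Finset.mul_sum, ← Finset.sum_div, sum_range_digits (Function.update m J 1) fun k =>
    ∏ s, modeFactor m J k s (digits m z s)]

/-- The memory at the start of the program. -/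
noncomputable def initialMemory : Memory where
  axis := 0
  modeRest := 0
  vertexRest := 0
  modeValue := 0
  vertexCount := 0
  longest := 0
  mode := 0
  vertex := 0
  exponent := 0
  eigenvalue := 0
  root := 0
  power := 0
  out := 0

theorem toState_initialMemory (m : Fin t → ℕ) : initialMemory.toState m = inputState m := by
  rw [Memory.toState]
  congr 1
  · ext i
    by_cases hi : ∃ v : WordVar, t + (1 + v.index) = i
    · obtain ⟨v, rfl⟩ := hi
      simp only [(WordVar.address_injective t).extend_apply, inputState]
      rw [if_neg (by lia), dif_neg (by lia)]
      cases v <;> rfl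
    · exact Function.extend_apply' _ _ _ hi
  · ext i
    by_cases hi : ∃ u : RealVar, ∏ s, m s + u.index = i
    · obtain ⟨u, rfl⟩ := hi
      rw [(RealVar.address_injective _).extend_apply]
      cases u <;> rfl
    · exact Function.extend_apply' _ _ _ hi

theorem runsIn_scanAxis (hw : WordsFit w m) (hs : a.axis = s) (hJ : a.longest = J)
    (hcount : a.vertexCount * m s ≤ ∏ s, m s) :
    RunsIn w 1 scanAxis (a.toState m)
      ({ a with
          vertexCount := a.vertexCount * m s
          longest := if m J < m s then s else J }.toState m) := by
  have haxis := hw.lt (s.is_lt.le.trans hw.dim_le)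
  have hlongest := hw.lt (J.is_lt.le.trans hw.dim_le)
  have hcount' := hw.lt ((Nat.le_mul_of_pos_right _ (hw.pos s)).trans hcount)
  let b : Memory := { a with vertexCount := a.vertexCount * m s }
  have htest := (evalsTo_maxLength (a := b) hw hJ).eval_lt_ne_zero_iff (evalsTo_axisLength hw hs)
  refine .seq (WordVar.runsIn_assign hw vertexCount
    ((evalsTo_value hw vertexCount rfl hcount').mul (evalsTo_axisLength hw hs) (hw.lt hcount)))
    (.ifWord le_rfl (fun h => ?_) fun h => ?_)
  · rw [if_pos (htest.1 h)]
    exact WordVar.runsIn_assign (a := b) hw longest (evalsTo_value hw axis hs haxis)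
  · rw [if_neg fun hlt => htest.2 hlt h]
    exact WordVar.runsIn_assign (a := b) hw longest (evalsTo_value hw longest hJ hlongest)

theorem runsIn_scan (hw : WordsFit w m) (ht : 0 < t) :
    ∃ (J : Fin t) (a : Memory), (∀ s, m s ≤ m J) ∧ a.longest = J ∧ a.vertexCount = ∏ s, m s ∧
      (∀ z, a.out z = 0) ∧ RunsIn w (t + 1) scan (inputState m) (a.toState m) := by
  have hone : 1 < 2 ^ w := by have := hw.lt_two_pow; lia
  have hinit := WordVar.runsIn_assign (m := m) (a := initialMemory) hw vertexCount (.const hone)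
  obtain ⟨a, ⟨⟨J, hJ, hmax⟩, hcount, hout⟩, hloop⟩ := runsIn_forLoop (v := axis) (e := dimension)
    (a := { initialMemory with vertexCount := 1 }) (body := scanAxis) hw
    (fun j b => (∃ J : Fin t, b.longest = J ∧ ∀ i : Fin t, i.val < j → m i ≤ m J) ∧
      b.vertexCount = ∏ i with i.val < j, m i ∧ ∀ z, b.out z = 0)
    le_rfl hw.dim_le (fun _ _ _ _ => evalsTo_dimension hw)
    (by
      rintro j hj b ⟨⟨J, hJ, hmax⟩, hcount, hout⟩
      have hcount' := prod_filter_val_lt_succ m ⟨j, hj⟩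
      have hle := Finset.prod_le_prod_of_subset_of_one_le' (f := m)
        (Finset.filter_subset (fun i : Fin t => i.val < j + 1) .univ) fun s _ _ => hw.pos s
      refine ⟨{ b with
          vertexCount := b.vertexCount * m ⟨j, hj⟩
          longest := if m J < m ⟨j, hj⟩ then j else J },
        ⟨⟨if m J < m ⟨j, hj⟩ then ⟨j, hj⟩ else J, ?_, fun i hi => ?_⟩, ?_, hout⟩,
        runsIn_scanAxis (a := { b with axis := j }) (s := ⟨j, hj⟩) hw rfl hJ ?_⟩
      · split_ifs <;> rfl
      · obtain hi | hi := (Nat.lt_succ_iff.1 hi).lt_or_eq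
        · have := hmax i hi
          split_ifs <;> lia
        · obtain rfl : i = ⟨j, hj⟩ := Fin.ext hi
          split_ifs <;> lia
      · exact (congrArg (· * m ⟨j, hj⟩) hcount).trans hcount'.symm
      · exact (congrArg (· * m ⟨j, hj⟩) hcount).trans_le (hcount'.symm.trans_le hle))
    ⟨⟨⟨0, ht⟩, rfl, by simp⟩, by simp, fun _ => rfl⟩
  rw [toState_initialMemory] at hinit
  refine ⟨J, a.set axis t, fun s => hmax s s.is_lt, hJ, ?_, hout, (hinit.mono (by lia)).seq
    (hloop.mono (by lia))⟩
  exact hcount.trans (prod_filter_val_lt_card m)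

theorem runsIn_greenProgram (hw : WordsFit w m) (ht : 0 < t)
    (hscale : ∀ b : Memory, scale.eval w (b.toState m) = S) :
    ∃ (J : Fin t) (a : Memory), (∀ s, m s ≤ m J) ∧
      (∀ z < ∏ s, m s, a.out z = S * torusRow m J (digits m z)) ∧
      RunsIn w (4 * (t * (∏ s, m s) * ((∏ s, m s) / m J))) (greenProgram scale) (inputState m)
        (a.toState m) := by
  obtain ⟨J, a, hmax, hJ, hn, hout, hscan⟩ := runsIn_scan hw ht
  obtain ⟨b, hb, hloop⟩ := runsIn_forLoop_mode hw hn hJ hout hscale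
  have hq : 1 ≤ (∏ s, m s) / m J := Nat.div_pos (hw.length_le J) (hw.pos J)
  have hprod : 1 ≤ ∏ s, m s := (hw.pos J).trans_le (hw.length_le J)
  have htime : (∏ s, m s) / m J * ((∏ s, m s) * (t + 1) + 1) + 1
      ≤ 4 * (t * (∏ s, m s) * ((∏ s, m s) / m J)) := by
    generalize (∏ s, m s) / m J = q at hq ⊢
    generalize ∏ s, m s = n at hprod ⊢
    have hnq : n * q ≤ t * n * q := Nat.mul_le_mul_right _ (Nat.le_mul_of_pos_left _ ht)
    have hqn : q ≤ n * q := Nat.le_mul_of_pos_left _ hprod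
    linarith [show q * (n * (t + 1) + 1) + 1 = t * n * q + n * q + q + 1 by ring]
  have htime' : t + 1 ≤ (∏ s, m s) / m J * ((∏ s, m s) * (t + 1) + 1) + 1 := by
    have := Nat.le_mul_of_pos_left (t + 1) hprod
    have := Nat.le_mul_of_pos_left ((∏ s, m s) * (t + 1) + 1) hq
    lia
  refine ⟨J, b, hmax, fun z hz => ?_, (hscan.mono (htime'.trans htime)).seq (hloop.mono htime)⟩
  rw [hb z hz, sum_modeTerm (hw.pos J)]

end

end RealRAM

/-! ### The three Laplacians -/

theorem three_le_prod {t : ℕ} {m : Fin t → ℕ} (ht : 1 ≤ t) (hm : ∀ s, 3 ≤ m s) :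
    3 ≤ ∏ s, m s :=
  (hm ⟨0, ht⟩).trans
    (Finset.single_le_prod' (fun s _ => (hm s).trans' (by lia)) (Finset.mem_univ _))

namespace RealRAM

/-- The expression for the factor by which the Green's function of a torus belonging to the
Laplacian `κ` differs from the one belonging to the combinatorial Laplacian. -/
def scaleExpr : LaplacianKind → RealExpr
  | .combinatorial => number 1
  | .normalized | .discrete => .mul (number 2) (.ofWord dimension)

variable {w t : ℕ} {m : Fin t → ℕ}

theorem eval_scaleExpr (hw : WordsFit w m) (κ : LaplacianKind) (a : Memory) :
    (scaleExpr κ).eval w (a.toState m) = κ.factor (2 * t) := by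
  cases κ <;>
    simp [scaleExpr, RealExpr.eval, eval_number hw, (evalsTo_dimension hw).1, LaplacianKind.factor]

theorem matrixOfRow_toState {J : Fin t} {S : ℝ} {a : Memory}
    (ha : ∀ z < ∏ s, m s, a.out z = S * torusRow m J (digits m z)) :
    matrixOfRow m (a.toState m) = S • torusGreen m J := by
  ext x y
  have hlt := (finPiFinEquiv (absDiff x y)).is_lt
  calc matrixOfRow m (a.toState m) x y = a.out (finPiFinEquiv (absDiff x y)) :=
        Function.extend_apply' _ _ _ fun ⟨_, hu⟩ => by lia
    _ = S * torusRow m J fun s => absDiff x y s := by rw [ha _ hlt, digits_finPiFinEquiv]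

theorem wordsFit_of_pow_le (ht : 1 ≤ t) (hm : ∀ s, 3 ≤ m s) (hw : (∏ s, m s) ^ 3 ≤ 2 ^ w) :
    WordsFit w m where
  pos s := three_pos.trans_le (hm s)
  dim_le := by
    have h := Finset.pow_card_le_prod .univ m 3 fun s _ => hm s
    rw [Finset.card_univ, Fintype.card_fin] at h
    exact (Nat.lt_pow_self (by lia)).le.trans h
  lt_two_pow := by
    have hn := three_le_prod ht hm
    refine lt_of_lt_of_le ?_ hw
    generalize ∏ s, m s = n at hn ⊢
    nlinarith [Nat.mul_le_mul hn hn, Nat.mul_le_mul_right n (Nat.mul_le_mul hn hn)]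

end RealRAM

theorem mul_div_le_rpow {n M t : ℕ} (ht : t ≠ 0) (hn : 0 < n) (hM : n ≤ M ^ t) :
    (n : ℝ) * (n / M : ℕ) ≤ (n : ℝ) ^ (2 - 1 / (t : ℝ)) := by
  have hn' : (0 : ℝ) < n := Nat.cast_pos.2 hn
  have hroot : (n : ℝ) ^ (1 / (t : ℝ)) ≤ M := by
    rw [one_div, Real.rpow_inv_le_iff_of_pos hn'.le M.cast_nonneg (by positivity),
      Real.rpow_natCast]
    exact_mod_cast hM
  rw [Real.rpow_sub hn', Real.rpow_two, sq, mul_div_assoc]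
  gcongr
  exact Nat.cast_div_le.trans (div_le_div_of_nonneg_left hn'.le (by positivity) hroot)

theorem one_le_log_of_three_le {n : ℕ} (hn : 3 ≤ n) : 1 ≤ Real.log n := by
  have hn' : (3 : ℝ) ≤ n := Nat.ofNat_le_cast.2 hn
  rw [Real.le_log_iff_exp_le (by linarith)]
  linarith [Real.exp_one_lt_d9]

open RealRAM in
theorem mainTheorem11_general (κ : LaplacianKind) :
    ∃ (P : RealRAM.Program) (c : ℕ) (C : ℝ),
      ∀ (t : ℕ) (m : Fin t → ℕ) (n w : ℕ), 1 ≤ t → (∀ s, 3 ≤ m s) → n = ∏ s, m s →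
        n ^ c ≤ 2 ^ w →
          ∃ (σ : RealRAM.State) (k : ℕ),
            RealRAM.Exec w P (RealRAM.inputState m) σ k ∧
            (k : ℝ) ≤ C * ((t : ℝ) * (n : ℝ) ^ (2 - 1 / (t : ℝ))) ∧
            matrixOfRow m σ = greenFunction (torus m) κ ∧
            IsPseudoInverse (laplacian (torus m) κ) (matrixOfRow m σ) := by
  let P := greenProgram (scaleExpr κ)
  refine ⟨P, 3, 4 * P.size, fun t m n w ht hm hn hw => ?_⟩
  subst hn
  have hfit := wordsFit_of_pow_le ht hm hw
  obtain ⟨J, a, hmax, hout, k, hk, hexec⟩ := runsIn_greenProgram hfit ht (eval_scaleExpr hfit κ)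
  have hreg := isRegularOfDegree_torus hm
  have hgreen := torusGreen_isPseudoInverse hm J
  have hd : 0 < 2 * t := by lia
  refine ⟨a.toState m, k, hexec, ?_, ?_, ?_⟩
  · have hprod : ∏ s, m s ≤ m J ^ t := by
      simpa using Finset.prod_le_pow_card .univ m (m J) fun s _ => hmax s
    have hpos := (hfit.pos J).trans_le (hfit.length_le J)
    calc (k : ℝ)
        ≤ 4 * P.size * (t * ((∏ s, m s : ℕ) * ((∏ s, m s) / m J : ℕ))) := by
          exact_mod_cast hk.trans_eq (by ring)
      _ ≤ _ := by gcongr; exact mul_div_le_rpow (by lia) hpos hprod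
  · rw [matrixOfRow_toState hout, greenFunction_of_regular _ κ hd hreg hgreen]
  · rw [matrixOfRow_toState hout]
    exact laplacian_isPseudoInverse_of_regular _ κ hd hreg hgreen

theorem mainTheorem11 (κ : LaplacianKind) :
    ∃ (P : RealRAM.Program) (c : ℕ) (C : ℝ),
      ∀ (t : ℕ) (m : Fin t → ℕ) (n w : ℕ), 1 ≤ t → (∀ s, 3 ≤ m s) → n = ∏ s, m s →
        n ^ c ≤ 2 ^ w →
          ∃ (σ : RealRAM.State) (k : ℕ),
            RealRAM.Exec w P (RealRAM.inputState m) σ k ∧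
            (k : ℝ) ≤ C * ((t : ℝ) * (n : ℝ) ^ (2 - 1 / (t : ℝ)) * Real.log n) ∧
            matrixOfRow m σ = greenFunction (torus m) κ ∧
            IsPseudoInverse (laplacian (torus m) κ) (matrixOfRow m σ) := by
  obtain ⟨P, c, C, h⟩ := mainTheorem11_general κ
  refine ⟨P, c, C, fun t m n w ht hm hn hw => ?_⟩
  obtain ⟨σ, k, hexec, hk, hX⟩ := h t m n w ht hm hn hw
  have hlog : 1 ≤ Real.log n := one_le_log_of_three_le (hn ▸ three_le_prod ht hm)
  refine ⟨σ, k, hexec, hk.trans ?_, hX⟩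
  rw [← mul_assoc C _ (Real.log n)]
  exact le_mul_of_one_le_right (k.cast_nonneg.trans hk) hlog
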